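/- **Model.** There are $n=2K$ candidates ($K\ge 1$), split into an advantaged group $G_1$ and a disadvantaged group $G_2$ with $|G_1|=|G_2|=K$, and $p\ge 1$ institutions with positive integer capacities $k_1,\dots,k_p$, $\sum_\ell k_\ell=K$. The latent utilities $u_i$ are drawn independently from a distribution $\mathcal D$ on $[0,1]$ with a log-concave density; the preference lists $\sigma_i$ (orderings of the $p$ institutions) are drawn independently from an arbitrary distribution $\mathcal L$, independently of the utilities. For a bias parameter $\beta>0$ the estimated utilities are $\hat u_i=u_i$ for $i\in G_1$ and $\hat u_i=\beta u_i$ for $i\in G_2$. An algorithm $\mathcal A$ maps $(\hat u,\sigma)$ to a partial assignment of candidates to institutions. It is *utility-maximizing* if its output always respects the capacities and has the largest total estimated utility of assigned candidates among all assignments respecting the capacities. The stable assignment algorithm $\mathcal A_{\rm st}$ processes the candidates in decreasing order of $\hat u_i$ and assigns each to the most preferred institution on its list that still has a vacant slot. Let $\rho_j$ (resp. $\pi_j$) be the fraction of the candidates of $G_j$ that are assigned to some institution (resp. to their first choice), and put $$\mathscr R(\mathcal A)=\mathbb E\Big[\tfrac{\min(\rho_1,\rho_2)}{\max(\rho_1,\rho_2)}\Big],\quad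 \mathscr P(\mathcal A)=\mathbb E\Big[\tfrac{\min(\pi_1,\pi_2)}{\max(\pi_1,\pi_2)}\Big],\quad \mathscr U(\mathcal A)=\mathbb E\Big[\tfrac{\sum_{i\text{ assigned}}u_i}{\mathsf U^\star(u)}\Big],$$ where $\mathsf U^\star(u)$ is the sum of the $K$ largest entries of $u$. Let $U(k,m)$ be the expected sum of the $k$ largest (of all, if $k\ge m$) among $m$ independent draws from $\mathcal D$. **Theorem.** There is an absolute constant $C>0$ (independent of $\mathcal D,\mathcal L,K,n,p,k_1,\dots,k_p,G_1,\beta$ and of the algorithm) such that the following hold. 1. If $0<\beta\le \tfrac12$, then for every utility-maximizing algorithm $\mathcal A$, $$\mathscr R(\mathcal A)\le 2\beta\ln(1/\beta)+C\,\frac{\sqrt{\log n}}{\sqrt n}.$$ 2. If $0<\beta\le \tfrac12$, then $$\mathscr P(\mathcal A_{\rm st})\le 2\beta\ln(1/\beta)+C\,\frac{p\sqrt{\log n}}{\sqrt n}.$$ 3. If $K\ge 2$, then, with everything but $\beta$ fixed, $\mathscr U(\mathcal A_{\rm st})$ converges as $\beta\to 0^+$, and $$\lim_{\beta\to0^+}\mathscr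 U(\mathcal A_{\rm st})\le \frac{U(K,K)+U\big(\lfloor C\sqrt{\log K}\rfloor,K\big)}{U(K,2K)}.$$ -/

import Mathlib

open MeasureTheory Filter Topology

/-- A preference list over the institutions `Fin p`: `s r` is the institution in position `r`
of the list, so `s 0` is the first choice. -/
abbrev PrefList (p : ℕ) := Equiv.Perm (Fin p)

/-- Preference lists form a finite discrete space. -/
instance prefListMeasurableSpace (p : ℕ) : MeasurableSpace (PrefList p) := ⊤

/-- A selection: a partial function from the candidates to the institutions. -/
abbrev Selection (n p : ℕ) := Fin n → Option (Fin p)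

/-- An algorithm: it sees the estimated utilities and the preference lists. -/
abbrev SelectionAlgorithm (n p : ℕ) := (Fin n → ℝ) → (Fin n → PrefList p) → Selection n p

noncomputable section

/-- The indices `0, …, m - 1` listed in decreasing order of `v` (ties broken by index). -/
def decOrder {m : ℕ} (v : Fin m → ℝ) : Equiv.Perm (Fin m) := Tuple.sort (fun i => -v i)

/-- Sum of the `k` largest among `v 0, …, v (m - 1)` (of all of them if `m ≤ k`). -/
def topSum {m : ℕ} (k : ℕ) (v : Fin m → ℝ) : ℝ :=
  ∑ i : Fin m with i.val < k, v (decOrder v i)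

/-- `U(k, m)`: the expected sum of the top `k` among `m` independent draws from `D`. -/
def expectedTopSum (D : Measure ℝ) (k m : ℕ) : ℝ :=
  ∫ v, topSum k v ∂(Measure.pi fun _ : Fin m => D)

/-- `D` is a probability distribution on `[0, 1]` with a log-concave density. -/
def HasLogConcaveDensity (D : Measure ℝ) : Prop :=
  ∃ f : ℝ → ℝ, Measurable f ∧ (∀ x, 0 ≤ f x) ∧ (∀ x, x ∉ Set.Icc (0 : ℝ) 1 → f x = 0) ∧
    (∫ x, f x = 1) ∧
    (∀ x ∈ Set.Icc (0 : ℝ) 1, ∀ y ∈ Set.Icc (0 : ℝ) 1, ∀ t ∈ Set.Icc (0 : ℝ) 1,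
      f x ^ (1 - t) * f y ^ t ≤ f ((1 - t) * x + t * y)) ∧
    D = volume.withDensity (fun x => ENNReal.ofReal (f x))

/-- Estimated utilities: those of the candidates outside the advantaged group `G₁` are scaled
by the bias parameter `β`. -/
def estimated {n : ℕ} (G₁ : Finset (Fin n)) (β : ℝ) (u : Fin n → ℝ) : Fin n → ℝ :=
  fun i => if i ∈ G₁ then u i else β * u i

/-- The candidates who are assigned to some institution. -/
def selected {n p : ℕ} (M : Selection n p) : Finset (Fin n) :=
  Finset.univ.filter fun i => M i ≠ none

/-- The candidates who are assigned to the first institution on their list. -/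
def firstChoice {n p : ℕ} [NeZero p] (s : Fin n → PrefList p) (M : Selection n p) :
    Finset (Fin n) :=
  Finset.univ.filter fun i => M i = some (s i 0)

/-- The total utility, with respect to `v`, of the candidates assigned by `M`. -/
def utility {n p : ℕ} (v : Fin n → ℝ) (M : Selection n p) : ℝ := ∑ i ∈ selected M, v i

/-- `M` respects the capacities `k`. -/
def Feasible {n p : ℕ} (k : Fin p → ℕ) (M : Selection n p) : Prop :=
  ∀ l, (Finset.univ.filter fun i => M i = some l).card ≤ k l

/-- The algorithm always outputs a selection that maximizes the estimated utility among the
selections respecting the capacities. -/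
def IsUtilityMaximizing {n p : ℕ} (k : Fin p → ℕ) (A : SelectionAlgorithm n p) : Prop :=
  ∀ (v : Fin n → ℝ) (s : Fin n → PrefList p), (∀ i, 0 ≤ v i) →
    Feasible k (A v s) ∧ ∀ M : Selection n p, Feasible k M → utility v M ≤ utility v (A v s)

/-- One step of the stable assignment algorithm. The state consists of the selection made so far
and of the numbers of vacant slots; candidate `a` is assigned to the first institution on its
list that has a vacant slot (and stays unassigned if there is none). -/
def stableStep {n p : ℕ} (s : Fin n → PrefList p) (state : Selection n p × (Fin p → ℕ))
    (a : Fin n) : Selection n p × (Fin p → ℕ) :=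
  match ((List.finRange p).map (s a)).find? (fun l => decide (0 < state.2 l)) with
  | none => state
  | some l => (Function.update state.1 a (some l), Function.update state.2 l (state.2 l - 1))

/-- The stable assignment algorithm with capacities `k`: process the candidates in decreasing
order of estimated utility. -/
def stableAlgorithm {n p : ℕ} (k : Fin p → ℕ) : SelectionAlgorithm n p := fun v s =>
  (((List.finRange n).map (decOrder v)).foldl (stableStep s) (fun _ => none, k)).1

/-- The law of the latent utilities and the preference lists: all utilities have law `D`, all
preference lists have law `L`, and everything is independent. -/
def instanceLaw (D : Measure ℝ) {p : ℕ} (L : Measure (PrefList p)) (n : ℕ) :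
    Measure ((Fin n → ℝ) × (Fin n → PrefList p)) :=
  (Measure.pi fun _ => D).prod (Measure.pi fun _ => L)

/-- The fraction of the group `G` that belongs to `S`. -/
def groupFraction {n : ℕ} (G S : Finset (Fin n)) : ℝ := ((S ∩ G).card : ℝ) / (G.card : ℝ)

/-- The ratio of the smaller to the larger group fraction, for the groups `G₁` and `G₁ᶜ`. -/
def fairnessRatio {n : ℕ} (G₁ S : Finset (Fin n)) : ℝ :=
  min (groupFraction G₁ S) (groupFraction G₁ᶜ S) / max (groupFraction G₁ S) (groupFraction G₁ᶜ S)

/-- Representational fairness. -/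
def representationalFairness {n p : ℕ} (D : Measure ℝ) (L : Measure (PrefList p))
    (G₁ : Finset (Fin n)) (β : ℝ) (A : SelectionAlgorithm n p) : ℝ :=
  ∫ w, fairnessRatio G₁ (selected (A (estimated G₁ β w.1) w.2)) ∂(instanceLaw D L n)

/-- Preference-based fairness. -/
def preferenceFairness {n p : ℕ} [NeZero p] (D : Measure ℝ) (L : Measure (PrefList p))
    (G₁ : Finset (Fin n)) (β : ℝ) (A : SelectionAlgorithm n p) : ℝ :=
  ∫ w, fairnessRatio G₁ (firstChoice w.2 (A (estimated G₁ β w.1) w.2)) ∂(instanceLaw D L n)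

/-- The utility ratio: the latent utility of the selected candidates over the sum of the top `K`
latent utilities, in expectation; `K` is the total capacity. -/
def utilityRatio {n p : ℕ} (D : Measure ℝ) (L : Measure (PrefList p))
    (G₁ : Finset (Fin n)) (K : ℕ) (β : ℝ) (A : SelectionAlgorithm n p) : ℝ :=
  ∫ w, utility w.1 (A (estimated G₁ β w.1) w.2) / topSum K w.1 ∂(instanceLaw D L n)

end

/-! Fairness. Fix a disadvantaged candidate `i` and everything except its utility `x`. The first
choice of `i` is still vacant exactly when its estimated value lies in an up-set `U` determined by
the others. If it is, the others are assigned as if that slot had been reserved, so the outcome for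
them depends neither on `x` nor on the group of `i` (`mem_firstChoice_update_of_ne`). Moving `i`
into the advantaged group therefore only replaces the event `β * x ∈ U` by `x ∈ U`.

Let `θ` be the infimum of `U` and `z = tail D θ`. Log-concavity gives `tail D (θ / β) ≤ z ^ (1 / β)`
(`tail_div_le`). With high probability at least `K` others exceed a level `t` with `tail D t + tail
D (t / β) = 1 + e`; they exhaust the capacity, so `t ≤ θ` and the two tails at `θ` add up to at most
`1 + e`. These two constraints bound their ratio by `2β log(1/β) + 2e` (`le_mul_of_le_rpow`).

To turn this into a bound on the expected ratio of counts, candidate `i` receives weight `1 / (1 +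
N)` on obtaining its first choice, where `N` counts the successful members of the advantaged group
other than `i`. After the move, the advantaged group has `K + 1` exchangeable members whose weights
sum to at most `1`, so each expects at most `1 / (K + 1)` (`integral_lowWeight_le`); summing the
comparison over the `K` disadvantaged candidates gives the claim. The actual ratio has denominator
`N`, not `1 + N`. For this reason only successes up to a high level `lam` are counted: the best
candidate typically lies above `lam`, is advantaged and obtains its first choice, which supplies the
missing `1` (`fairnessRatio_le_sum`).

Any utility-maximizing algorithm almost surely selects the top `K` estimated values. With a single
institution being selected means obtaining the first choice, so representational fairness is the
case `p = 1` of preference fairness.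

Utility. Once `β` is below every utility, exactly the advantaged group is selected, so the limit is
the expectation of `A / B`, with `A` the utility of the group and `B` the sum of the top `K`.
Efron–Stein and a reverse moment inequality make both variances `O(K μ²)`, where `μ` is the mean of
`D`. As `𝔼 B ≥ K μ`, replacing `𝔼[A / B]` by `𝔼 A / 𝔼 B` costs only `O(μ) / 𝔼 B`
(`integral_ratio_le`), and a top sum of a bounded number of terms absorbs this. -/

noncomputable section

/-! ### Dynamics of the stable assignment. -/

variable {n p : ℕ}

/-- The institution chosen by a candidate with list `t` when `c` lists the vacant slots. -/
def choice (c : Fin p → ℕ) (t : PrefList p) : Option (Fin p) :=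
  ((List.finRange p).map t).find? (fun l => decide (0 < c l))

/-- Process the candidates in the list `l`, starting from the state `st`. -/
def runList (s : Fin n → PrefList p) (l : List (Fin n)) (st : Selection n p × (Fin p → ℕ)) :
    Selection n p × (Fin p → ℕ) :=
  l.foldl (stableStep s) st

theorem stableStep_of_none {s : Fin n → PrefList p} {st : Selection n p × (Fin p → ℕ)} {a : Fin n}
    (h : choice st.2 (s a) = none) : stableStep s st a = st := by
  unfold stableStep; unfold choice at h; rw [h]

theorem stableStep_of_some {s : Fin n → PrefList p} {st : Selection n p × (Fin p → ℕ)} {a : Fin n}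
    {l : Fin p} (h : choice st.2 (s a) = some l) :
    stableStep s st a =
      (Function.update st.1 a (some l), Function.update st.2 l (st.2 l - 1)) := by
  unfold stableStep; unfold choice at h; rw [h]

theorem choice_eq_none_iff {c : Fin p → ℕ} {t : PrefList p} :
    choice c t = none ↔ ∀ l, c l = 0 := by
  simp only [choice, List.find?_eq_none, List.mem_map, List.mem_finRange, true_and,
    decide_eq_true_eq, not_lt, Nat.le_zero, forall_exists_index, forall_apply_eq_imp_iff]
  exact ⟨fun h l => by simpa using h (t.symm l), fun h l => h _⟩

theorem choice_pos {c : Fin p → ℕ} {t : PrefList p} {l : Fin p} (h : choice c t = some l) :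
    0 < c l := by
  have := List.find?_some h
  simpa using this

theorem List.find?_eq_some_of_imp {α : Type*} {q q' : α → Bool} {l : List α} {a : α}
    (h : l.find? q = some a) (hq : ∀ b, q' b → q b) (ha : q' a) : l.find? q' = some a := by
  induction l with
  | nil => simp at h
  | cons b l ih =>
    rw [List.find?_cons] at h ⊢
    cases hb : q b with
    | true =>
      rw [hb] at h
      simp only [Option.some.injEq] at h
      subst h
      simp [ha]
    | false =>
      rw [hb] at h
      have : q' b = false := by
        cases hb' : q' b with
        | false => rfl
        | true => rw [hq b hb'] at hb; exact absurd hb (by simp)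
      rw [this]
      exact ih h

/-- Losing slots cannot open an institution ranked earlier, so the first open one stays first while
it is open. -/
theorem choice_eq_of_le {c c' : Fin p → ℕ} {t : PrefList p} {l : Fin p}
    (h : choice c t = some l) (hc : ∀ m, c' m ≤ c m) (hl : 0 < c' l) : choice c' t = some l := by
  refine List.find?_eq_some_of_imp h (fun m hm => ?_) (by simpa using hl)
  have := hc m
  simp only [decide_eq_true_eq] at hm ⊢
  omega

theorem choice_eq_first_iff [NeZero p] {c : Fin p → ℕ} {t : PrefList p} :
    choice c t = some (t 0) ↔ 0 < c (t 0) := by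
  refine ⟨choice_pos, fun h => ?_⟩
  obtain ⟨m, rfl⟩ := Nat.exists_eq_succ_of_ne_zero (NeZero.ne p)
  unfold choice
  rw [List.finRange_succ, List.map_cons, List.find?_cons]
  simp [h]

theorem runList_cons (s : Fin n → PrefList p) (a : Fin n) (l : List (Fin n)) (st) :
    runList s (a :: l) st = runList s l (stableStep s st a) := rfl

theorem runList_append (s : Fin n → PrefList p) (l l' : List (Fin n)) (st) :
    runList s (l ++ l') st = runList s l' (runList s l st) := by
  simp [runList, List.foldl_append]

/-- Lists rank all institutions, so a candidate is rejected only when no slot is left; the truncated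
subtraction covers that case as `0 - 1 = 0`. -/
theorem sum_snd_stableStep (s : Fin n → PrefList p) (st) (a : Fin n) :
    ∑ m, (stableStep s st a).2 m = ∑ m, st.2 m - 1 := by
  cases h : choice st.2 (s a) with
  | none =>
    rw [stableStep_of_none h]
    rw [choice_eq_none_iff] at h
    simp [h]
  | some l =>
    rw [stableStep_of_some h]
    have hl := choice_pos h
    have h1 := Finset.sum_update_of_mem (Finset.mem_univ l) st.2 (st.2 l - 1)
    have h2 := Finset.sum_erase_eq_sub (f := fun m => (st.2 m : ℤ)) (Finset.mem_univ l)
    have h3 := Finset.add_sum_erase Finset.univ st.2 (Finset.mem_univ l)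
    rw [← Finset.erase_eq] at h1
    simp only [h1]
    omega

theorem sum_snd_runList (s : Fin n → PrefList p) (l : List (Fin n)) (st) :
    ∑ m, (runList s l st).2 m = ∑ m, st.2 m - l.length := by
  induction l generalizing st with
  | nil => simp [runList]
  | cons a l ih => rw [runList_cons, ih, sum_snd_stableStep, List.length_cons]; omega

theorem snd_stableStep_le (s : Fin n → PrefList p) (st) (a : Fin n) (m : Fin p) :
    (stableStep s st a).2 m ≤ st.2 m := by
  cases h : choice st.2 (s a) with
  | none => rw [stableStep_of_none h]
  | some l =>
    rw [stableStep_of_some h]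
    by_cases hm : m = l
    · subst hm; simp
    · simp [hm]

theorem snd_runList_le (s : Fin n → PrefList p) (l : List (Fin n)) (st) (m : Fin p) :
    (runList s l st).2 m ≤ st.2 m := by
  induction l generalizing st with
  | nil => simp [runList]
  | cons a l ih => exact (ih _).trans (snd_stableStep_le _ _ _ _)

theorem snd_stableStep_congr (s : Fin n → PrefList p) {st st' : Selection n p × (Fin p → ℕ)}
    (h : st.2 = st'.2) (a : Fin n) : (stableStep s st a).2 = (stableStep s st' a).2 := by
  unfold stableStep; rw [h]; split <;> simp_all

theorem fst_stableStep_congr (s : Fin n → PrefList p) {st st' : Selection n p × (Fin p → ℕ)}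
    (h : st.2 = st'.2) (a : Fin n) {j : Fin n} (hj : st.1 j = st'.1 j) :
    (stableStep s st a).1 j = (stableStep s st' a).1 j := by
  unfold stableStep
  rw [h]
  split
  · exact hj
  · by_cases hja : j = a
    · subst hja; simp
    · simp [hja, hj]

theorem fst_stableStep_of_ne (s : Fin n → PrefList p) (st) {a j : Fin n} (h : j ≠ a) :
    (stableStep s st a).1 j = st.1 j := by
  unfold stableStep
  split
  · rfl
  · simp [h]

theorem fst_runList_of_notMem (s : Fin n → PrefList p) (l : List (Fin n)) (st) {j : Fin n}
    (h : j ∉ l) : (runList s l st).1 j = st.1 j := by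
  induction l generalizing st with
  | nil => rfl
  | cons a l ih =>
    rw [List.mem_cons, not_or] at h
    rw [runList_cons, ih _ h.2, fst_stableStep_of_ne s st h.1]

/-- Earlier assignments influence later ones only through the vacancy counts. -/
theorem fst_runList_congr (s : Fin n → PrefList p) (l : List (Fin n))
    {st st' : Selection n p × (Fin p → ℕ)} (h : st.2 = st'.2) {j : Fin n}
    (hj : st.1 j = st'.1 j) : (runList s l st).1 j = (runList s l st').1 j := by
  induction l generalizing st st' with
  | nil => exact hj
  | cons a l ih =>
    exact ih (snd_stableStep_congr s h a) (fst_stableStep_congr s h a hj)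

/-- The assignment of `i` is its choice among the slots that its predecessors leave vacant. -/
theorem fst_runList_append_cons (s : Fin n → PrefList p) (l l' : List (Fin n))
    (st : Selection n p × (Fin p → ℕ)) {i : Fin n} (hi : i ∉ l) (hi' : i ∉ l')
    (h0 : st.1 i = none) :
    (runList s (l ++ i :: l') st).1 i = choice (runList s l st).2 (s i) := by
  rw [runList_append, runList_cons, fst_runList_of_notMem _ _ _ hi']
  cases h : choice (runList s l st).2 (s i) with
  | none => rw [stableStep_of_none h, fst_runList_of_notMem _ _ _ hi, h0]
  | some m => rw [stableStep_of_some h]; simp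

/-- Removing a slot that is not needed does not change the run. -/
theorem runList_reserve (s : Fin n → PrefList p) (l : List (Fin n)) (M : Selection n p)
    (c : Fin p → ℕ) (m : Fin p) (h : 0 < (runList s l (M, c)).2 m) :
    runList s l (M, Function.update c m (c m - 1)) =
      ((runList s l (M, c)).1,
        Function.update (runList s l (M, c)).2 m ((runList s l (M, c)).2 m - 1)) := by
  induction l generalizing M c with
  | nil => rfl
  | cons a l ih =>
    rw [runList_cons] at h
    rw [runList_cons, runList_cons]
    cases hc : choice c (s a) with
    | none =>
      rw [stableStep_of_none (st := (M, c)) hc] at h ⊢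
      rw [stableStep_of_none]
      · exact ih M c h
      · rw [choice_eq_none_iff] at hc ⊢
        intro q
        by_cases hq : q = m
        · subst hq; simp [hc]
        · simp [hq, hc]
    | some q =>
      rw [stableStep_of_some (st := (M, c)) hc] at h ⊢
      have hm := h.trans_le (snd_runList_le _ _ _ m)
      have hq : 0 < c q := choice_pos hc
      have hc' : choice (Function.update c m (c m - 1)) (s a) = some q := by
        refine choice_eq_of_le hc (fun r => ?_) ?_
        · by_cases hr : r = m
          · subst hr; simp
          · simp [hr]
        · by_cases hr : q = m
          -- If the candidate itself takes a slot at `m`, then `hm` leaves another one there, so at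
          -- least two were vacant and the reduced capacity still admits it.
          · subst hr; simp at hm ⊢; omega
          · simpa [hr] using hq
      rw [stableStep_of_some (st := (M, Function.update c m (c m - 1))) hc', ← ih _ _ h]
      congr 2
      by_cases hr : q = m
      · subst hr; simp
      · simp only [ne_eq, hr, not_false_eq_true, Function.update_of_ne]
        rw [Function.update_of_ne (Ne.symm hr), Function.update_comm hr]

/-- If `i` obtains its first choice, then the others are assigned as if `i` were absent and the
slot of `i` were reserved. -/
theorem fst_runList_insert (s : Fin n → PrefList p) (l l' : List (Fin n)) (c : Fin p → ℕ)
    {i j : Fin n} {m : Fin p} (hm : choice (runList s l (fun _ => none, c)).2 (s i) = some m)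
    (hj : j ≠ i) :
    (runList s (l ++ i :: l') (fun _ => none, c)).1 j =
      (runList s (l ++ l') (fun _ => none, Function.update c m (c m - 1))).1 j := by
  rw [runList_append, runList_append, runList_cons, runList_reserve s l _ _ _ (choice_pos hm),
    stableStep_of_some hm]
  refine fst_runList_congr s l' ?_ ?_
  · rfl
  · simp [hj]

/-- The invariant is an inequality because the list is arbitrary: a candidate processed twice would
leave its first institution without returning the slot. -/
theorem feasible_runList_aux (s : Fin n → PrefList p) (l : List (Fin n)) (k : Fin p → ℕ)
    (st : Selection n p × (Fin p → ℕ))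
    (h : ∀ m, (Finset.univ.filter fun i => st.1 i = some m).card + st.2 m ≤ k m) (m : Fin p) :
    (Finset.univ.filter fun i => (runList s l st).1 i = some m).card + (runList s l st).2 m
      ≤ k m := by
  induction l generalizing st with
  | nil => exact h m
  | cons a l ih =>
    refine ih _ fun q => ?_
    cases hc : choice st.2 (s a) with
    | none => rw [stableStep_of_none hc]; exact h q
    | some r =>
      rw [stableStep_of_some hc]
      have hr := choice_pos hc
      have hq := h q
      by_cases hqr : q = r
      · subst hqr
        have : (Finset.univ.filter fun i => Function.update st.1 a (some q) i = some q) ⊆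
            insert a (Finset.univ.filter fun i => st.1 i = some q) := by
          intro i hi
          by_cases hia : i = a
          · simp [hia]
          · simpa [hia] using hi
        have := (Finset.card_le_card this).trans (Finset.card_insert_le _ _)
        simp only [Function.update_self]
        omega
      · have : (Finset.univ.filter fun i => Function.update st.1 a (some r) i = some q) ⊆
            (Finset.univ.filter fun i => st.1 i = some q) := by
          intro i hi
          by_cases hia : i = a
          · subst hia
            simp [Ne.symm hqr] at hi
          · simpa [hia] using hi
        have := (Finset.card_le_card this)
        simp only [ne_eq, hqr, not_false_eq_true, Function.update_of_ne]
        omega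

/-- Complete lists make every candidate take a slot until none is left, so preferences do not affect
who is selected. -/
theorem selected_runList (s : Fin n → PrefList p) (l : List (Fin n))
    (st : Selection n p × (Fin p → ℕ)) :
    selected (runList s l st).1 = selected st.1 ∪ (l.take (∑ m, st.2 m)).toFinset := by
  induction l generalizing st with
  | nil => simp [runList]
  | cons a l ih =>
    rw [runList_cons, ih, sum_snd_stableStep]
    cases hc : choice st.2 (s a) with
    | none =>
      rw [stableStep_of_none hc]
      have : ∑ m, st.2 m = 0 := by
        rw [choice_eq_none_iff] at hc
        simp [hc]
      simp [this]
    | some r =>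
      rw [stableStep_of_some hc]
      have hr := choice_pos hc
      have : 0 < ∑ m, st.2 m :=
        hr.trans_le (Finset.single_le_sum (fun _ _ => Nat.zero_le _) (Finset.mem_univ r))
      obtain ⟨q, hq⟩ := Nat.exists_eq_succ_of_ne_zero this.ne'
      rw [hq]
      ext i
      by_cases hia : i = a
      · subst hia; simp [selected]
      · simp [selected, hia]

/-! ### Order of processing and the selected set. -/

/-- The candidates in the order of processing. -/
def orderList (v : Fin n → ℝ) : List (Fin n) := (List.finRange n).map (decOrder v)

theorem stableAlgorithm_eq (k : Fin p → ℕ) (v : Fin n → ℝ) (s : Fin n → PrefList p) :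
    stableAlgorithm k v s = (runList s (orderList v) (fun _ => none, k)).1 := rfl

theorem feasible_stableAlgorithm (k : Fin p → ℕ) (v : Fin n → ℝ) (s : Fin n → PrefList p) :
    Feasible k (stableAlgorithm k v s) := fun m =>
  (Nat.le_add_right _ _).trans
    (feasible_runList_aux s (orderList v) k (fun _ => none, k) (by simp) m)

/-- The indices of the `k` largest entries. -/
def topSet (k : ℕ) (v : Fin n → ℝ) : Finset (Fin n) :=
  (Finset.univ.filter fun i : Fin n => i.val < k).map (decOrder v).toEmbedding

theorem topSum_eq (k : ℕ) (v : Fin n → ℝ) : topSum k v = ∑ i ∈ topSet k v, v i := by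
  simp [topSum, topSet]

theorem selected_stableAlgorithm (k : Fin p → ℕ) (v : Fin n → ℝ) (s : Fin n → PrefList p) :
    selected (stableAlgorithm k v s) = topSet (∑ l, k l) v := by
  rw [stableAlgorithm_eq, selected_runList]
  ext i
  simp only [selected, topSet, orderList]
  simp only [ne_eq, not_true_eq_false, Finset.filter_false, Finset.empty_union, List.mem_toFinset,
    ← List.map_take, List.mem_map, Finset.mem_map, Finset.mem_filter, Finset.mem_univ, true_and,
    Equiv.coe_toEmbedding]
  refine exists_congr fun a => and_congr_left fun _ => ?_
  rw [List.mem_take_iff_getElem]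
  constructor
  · rintro ⟨j, hj, rfl⟩
    simp at hj ⊢; omega
  · intro h
    exact ⟨a, by simp [h], by simp⟩

theorem antitone_decOrder (v : Fin n → ℝ) : Antitone (v ∘ decOrder v) := by
  intro i j hij
  have := Tuple.monotone_sort (fun i => -v i) hij
  simpa [decOrder] using this

theorem topSet_le {k : ℕ} {v : Fin n → ℝ} {a b : Fin n} (ha : a ∈ topSet k v)
    (hb : b ∉ topSet k v) : v b ≤ v a := by
  simp only [topSet, Finset.mem_map, Finset.mem_filter, Finset.mem_univ, true_and,
    Equiv.coe_toEmbedding] at ha hb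
  obtain ⟨i, hi, rfl⟩ := ha
  obtain ⟨j, rfl⟩ := (decOrder v).surjective b
  have hj : ¬ j.val < k := fun h => hb ⟨j, h, rfl⟩
  exact antitone_decOrder v (show i ≤ j by rw [Fin.le_def]; omega)

theorem card_topSet {k : ℕ} (hk : k ≤ n) (v : Fin n → ℝ) : (topSet k v).card = k := by
  rw [topSet, Finset.card_map]
  rw [Fin.card_filter_val_lt, Nat.min_eq_right hk]

theorem pairwise_orderList (v : Fin n → ℝ) : (orderList v).Pairwise (fun a b => v b ≤ v a) := by
  rw [orderList, List.pairwise_map]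
  exact (List.pairwise_lt_finRange n).imp fun h => antitone_decOrder v h.le

theorem nodup_orderList (v : Fin n → ℝ) : (orderList v).Nodup :=
  (List.nodup_finRange n).map (decOrder v).injective

theorem mem_orderList (v : Fin n → ℝ) (a : Fin n) : a ∈ orderList v := by
  simp only [orderList, List.mem_map, List.mem_finRange, true_and]
  exact (decOrder v).surjective a

theorem List.eq_filter_append_filter {α : Type*} (v : α → ℝ) (x : ℝ) (l : List α)
    (h : l.Pairwise (fun a b => v b ≤ v a)) :
    l = l.filter (fun a => decide (x < v a)) ++ l.filter (fun a => decide (v a ≤ x)) := by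
  induction l with
  | nil => rfl
  | cons a l ih =>
    rw [List.pairwise_cons] at h
    by_cases hx : x < v a
    · rw [List.filter_cons_of_pos (by simpa using hx), List.filter_cons_of_neg (by simpa using hx),
        List.cons_append, ← ih h.2]
    · have h1 : (a :: l).filter (fun a => decide (x < v a)) = [] := by
        rw [List.filter_eq_nil_iff]
        intro b hb
        rcases List.mem_cons.1 hb with rfl | hb
        · simpa using hx
        · have := h.1 b hb
          simp only [decide_eq_true_eq]
          linarith
      have h2 : (a :: l).filter (fun a => decide (v a ≤ x)) = a :: l := by
        rw [List.filter_eq_self]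
        intro b hb
        rcases List.mem_cons.1 hb with rfl | hb
        · simpa using hx
        · have := h.1 b hb
          simp only [decide_eq_true_eq]
          linarith
      rw [h1, h2, List.nil_append]

/-- For distinct values, the order of processing is the only sorted list of all candidates. -/
theorem eq_orderList {v : Fin n → ℝ} (hv : Function.Injective v) {l : List (Fin n)}
    (hl : l.Nodup) (hmem : ∀ a, a ∈ l) (hs : l.Pairwise (fun a b => v b ≤ v a)) :
    l = orderList v := by
  refine List.Perm.eq_of_pairwise (le := fun a b => v b ≤ v a)
    (fun a b _ _ hab hba => hv (le_antisymm hba hab)) hs (pairwise_orderList v) ?_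
  rw [List.perm_ext_iff_of_nodup hl (nodup_orderList v)]
  simp [hmem, mem_orderList]

/-- The other candidates in the order of processing. -/
def othersList (v : Fin n → ℝ) (i : Fin n) : List (Fin n) := (orderList v).filter (fun j => j ≠ i)

theorem pairwise_othersList (v : Fin n → ℝ) (i : Fin n) :
    (othersList v i).Pairwise (fun a b => v b ≤ v a) := (pairwise_orderList v).filter _

theorem orderList_update {v : Fin n → ℝ} {i : Fin n} {x : ℝ}
    (hx : Function.Injective (Function.update v i x)) :
    orderList (Function.update v i x) =
      (othersList v i).filter (fun a => decide (x < v a)) ++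
        i :: (othersList v i).filter (fun a => decide (v a ≤ x)) := by
  symm
  have hne : ∀ a, a ∈ othersList v i ↔ a ≠ i := by
    intro a
    simp [othersList, mem_orderList]
  have hsplit := List.eq_filter_append_filter v x _ (pairwise_othersList v i)
  refine eq_orderList hx ?_ ?_ ?_
  · rw [List.nodup_middle, ← hsplit, List.nodup_cons]
    exact ⟨by simp [hne], (nodup_orderList v).filter _⟩
  · intro a
    by_cases ha : a = i
    · simp [ha]
    · rw [List.perm_middle.mem_iff, ← hsplit, List.mem_cons, hne]
      exact Or.inr ha
  · have hp := pairwise_othersList v i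
    rw [List.pairwise_append, List.pairwise_cons]
    have hup : ∀ a ∈ othersList v i, Function.update v i x a = v a := fun a ha =>
      Function.update_of_ne ((hne a).1 ha) _ _
    refine ⟨?_, ⟨?_, ?_⟩, ?_⟩
    · refine (hp.filter _).imp_of_mem fun {a b} ha hb h => ?_
      rw [hup a (List.mem_of_mem_filter ha), hup b (List.mem_of_mem_filter hb)]
      exact h
    · intro b hb
      rw [hup b (List.mem_of_mem_filter hb), Function.update_self]
      simpa using (List.mem_filter.1 hb).2
    · refine (hp.filter _).imp_of_mem fun {a b} ha hb h => ?_
      rw [hup a (List.mem_of_mem_filter ha), hup b (List.mem_of_mem_filter hb)]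
      exact h
    · intro a ha b hb
      rw [hup a (List.mem_of_mem_filter ha)]
      have h1 : x < v a := by simpa using (List.mem_filter.1 ha).2
      rcases List.mem_cons.1 hb with rfl | hb
      · rw [Function.update_self]; exact h1.le
      · rw [hup b (List.mem_of_mem_filter hb)]
        have h2 : v b ≤ x := by simpa using (List.mem_filter.1 hb).2
        linarith

end

/-! ### Top sums and thresholds. -/

noncomputable section

variable {n p : ℕ}

/-- After subtracting the threshold the terms are nonnegative on `T` and nonpositive off it, so `T`
is optimal among sets of any size. -/
theorem sum_le_sum_of_threshold {S T : Finset (Fin n)} {v : Fin n → ℝ} {c : ℝ}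
    (hT : ∀ a ∈ T, c ≤ v a) (hS : ∀ b ∉ T, v b ≤ c) :
    ∑ i ∈ S, (v i - c) ≤ ∑ i ∈ T, (v i - c) := by
  calc ∑ i ∈ S, (v i - c) ≤ ∑ i ∈ S ∩ T, (v i - c) := by
        rw [← Finset.sum_inter_add_sum_sdiff S T fun i => v i - c]
        have : ∑ i ∈ S \ T, (v i - c) ≤ 0 := Finset.sum_nonpos fun i hi => by
          have := hS i (Finset.mem_sdiff.1 hi).2
          linarith
        linarith
    _ ≤ ∑ i ∈ T, (v i - c) :=
        Finset.sum_le_sum_of_subset_of_nonneg Finset.inter_subset_right fun i hi _ => by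
          have := hT i hi
          linarith

theorem exists_threshold_topSet {k : ℕ} (hk : 1 ≤ k) (hkn : k ≤ n) (v : Fin n → ℝ) :
    ∃ a ∈ topSet k v, ∀ b ∈ topSet k v, v a ≤ v b := by
  refine Finset.exists_min_image _ _ ?_
  rw [← Finset.card_pos, card_topSet hkn]
  exact hk

/-- `topSum k v` is the largest sum of `k` entries. -/
theorem sum_le_topSum {k : ℕ} (hkn : k ≤ n) {S : Finset (Fin n)} (hS : S.card = k)
    (v : Fin n → ℝ) : ∑ i ∈ S, v i ≤ topSum k v := by
  rcases Nat.eq_zero_or_pos k with rfl | hk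
  · simp [Finset.card_eq_zero.1 hS, topSum]
  obtain ⟨a, ha, hmin⟩ := exists_threshold_topSet hk hkn v
  have := sum_le_sum_of_threshold (S := S) hmin fun b hb => topSet_le ha hb
  rw [topSum_eq]
  simp only [Finset.sum_sub_distrib, Finset.sum_const, hS, card_topSet hkn] at this
  linarith

theorem sum_le_topSum_of_nonneg {k : ℕ} (hkn : k ≤ n) {S : Finset (Fin n)} (hS : S.card ≤ k)
    {v : Fin n → ℝ} (hv : ∀ i, 0 ≤ v i) : ∑ i ∈ S, v i ≤ topSum k v := by
  obtain ⟨T, hST, hT⟩ := Finset.exists_superset_card_eq hS (by simpa using hkn)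
  exact (Finset.sum_le_sum_of_subset_of_nonneg hST fun i _ _ => hv i).trans (sum_le_topSum hkn hT v)

theorem topSum_le_add {k : ℕ} (hkn : k ≤ n) (v w : Fin n → ℝ) :
    topSum k v ≤ topSum k w + ∑ i, |v i - w i| := by
  have h1 := sum_le_topSum hkn (card_topSet hkn v) w
  have h2 : ∑ i ∈ topSet k v, (v i - w i) ≤ ∑ i, |v i - w i| :=
    (Finset.sum_le_sum fun i _ => le_abs_self _).trans
      (Finset.sum_le_sum_of_subset_of_nonneg (Finset.subset_univ _) fun i _ _ => abs_nonneg _)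
  rw [Finset.sum_sub_distrib, ← topSum_eq] at h2
  linarith

theorem abs_topSum_sub_le {k : ℕ} (hkn : k ≤ n) (v w : Fin n → ℝ) :
    |topSum k v - topSum k w| ≤ ∑ i, |v i - w i| := by
  have h1 := topSum_le_add hkn v w
  have h2 := topSum_le_add hkn w v
  simp only [abs_sub_comm (w _) (v _)] at h2
  rw [abs_le]
  constructor <;> linarith

/-- For distinct positive values, the maximizer of the total value is unique. -/
theorem eq_topSet_of_topSum_le {k : ℕ} (hkn : k ≤ n) {S : Finset (Fin n)} (hS : S.card ≤ k)
    {v : Fin n → ℝ} (hv : ∀ i, 0 < v i) (hinj : Function.Injective v)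
    (h : topSum k v ≤ ∑ i ∈ S, v i) : S = topSet k v := by
  rcases Nat.eq_zero_or_pos k with rfl | hk
  · rw [Finset.card_eq_zero.1 (Nat.le_zero.1 hS)]
    simp [topSet]
  obtain ⟨a, ha, hmin⟩ := exists_threshold_topSet hk hkn v
  -- A smaller set could be enlarged, which strictly increases the sum of positive values.
  have hcard : S.card = k := by
    by_contra hne
    obtain ⟨b, hb⟩ : ∃ b, b ∉ S := by
      by_contra! hall
      have : S.card = n := by simp [Finset.eq_univ_of_forall hall]
      omega
    have h1 := sum_le_topSum_of_nonneg hkn (S := insert b S)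
      (by rw [Finset.card_insert_of_notMem hb]; omega) fun i => (hv i).le
    rw [Finset.sum_insert hb] at h1
    have := hv b
    linarith
  refine Finset.eq_of_subset_of_card_le (fun b hb => ?_) (by rw [card_topSet hkn, hcard])
  -- An element of `S` outside the top set lies strictly below the threshold `v a`; erasing it
  -- raises the shifted sum above its maximum.
  by_contra hbT
  have hlt : v b < v a := lt_of_le_of_ne (topSet_le ha hbT) fun heq => hbT (hinj heq ▸ ha)
  have h1 := sum_le_sum_of_threshold (S := S.erase b) hmin fun b hb => topSet_le ha hb
  have h2 := Finset.add_sum_erase S (fun i => v i - v a) hb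
  rw [topSum_eq] at h
  simp only [Finset.sum_sub_distrib, Finset.sum_const, hcard, card_topSet hkn] at h1 h2
  linarith

theorem topSet_eq_of_separated {k : ℕ} (hkn : k ≤ n) {G : Finset (Fin n)} (hG : G.card = k)
    {v : Fin n → ℝ} (h : ∀ a ∈ G, ∀ b ∉ G, v b < v a) : topSet k v = G := by
  refine Finset.eq_of_subset_of_card_le (fun a ha => ?_) (by rw [card_topSet hkn, hG])
  by_contra haG
  obtain ⟨b, hb, hbT⟩ : ∃ b ∈ G, b ∉ topSet k v := by
    by_contra! hall
    have := Finset.eq_of_subset_of_card_le hall (by rw [card_topSet hkn, hG])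
    exact haG (this ▸ ha)
  exact absurd (topSet_le ha hbT) (not_le.2 (h b hb a haG))

/-! ### Inserting a candidate -/

/-- The values at which an additional candidate still finds a vacant slot at `l`. -/
def openValues (k : Fin p → ℕ) (s : Fin n → PrefList p) (v : Fin n → ℝ) (i : Fin n) (l : Fin p) :
    Set ℝ :=
  {x | 0 < (runList s ((othersList v i).filter (fun a => decide (x < v a))) (fun _ => none, k)).2 l}

/-- A larger value has as predecessors an initial segment of the former ones, and vacancies only
decrease along a run. -/
theorem openValues_of_le {k : Fin p → ℕ} {s : Fin n → PrefList p} {v : Fin n → ℝ} {i : Fin n}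
    {l : Fin p} {x y : ℝ} (hx : x ∈ openValues k s v i l) (hxy : x ≤ y) :
    y ∈ openValues k s v i l := by
  have h := List.eq_filter_append_filter v y _
    ((pairwise_othersList v i).filter (fun a => decide (x < v a)))
  rw [List.filter_filter] at h
  have h' : (othersList v i).filter (fun a => decide (y < v a) && decide (x < v a)) =
      (othersList v i).filter (fun a => decide (y < v a)) := by
    refine List.filter_congr fun a _ => ?_
    by_cases hy : y < v a
    · simp [hy, hxy.trans_lt hy]
    · simp [hy]
  rw [h'] at h
  unfold openValues at hx ⊢
  rw [Set.mem_ofPred_eq, h, runList_append] at hx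
  exact hx.trans_le (snd_runList_le _ _ _ _)

/-- A value at or below `t` is preceded by enough candidates to use up all slots. -/
theorem lt_of_mem_openValues {k : Fin p → ℕ} {s : Fin n → PrefList p} {v : Fin n → ℝ} {i : Fin n}
    {l : Fin p} {t x : ℝ} (h : ∑ l, k l ≤ (Finset.univ.filter fun j => j ≠ i ∧ t < v j).card)
    (hx : x ∈ openValues k s v i l) : t < x := by
  by_contra! hxt
  have h1 := sum_snd_runList s ((othersList v i).filter (fun a => decide (x < v a)))
    (fun _ => none, k)
  have h2 : (Finset.univ.filter fun j => j ≠ i ∧ t < v j).card ≤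
      ((othersList v i).filter (fun a => decide (x < v a))).length := by
    have hn : ((othersList v i).filter (fun a => decide (x < v a))).Nodup :=
      List.Nodup.filter _ (List.Nodup.filter _ (nodup_orderList v))
    rw [← List.toFinset_card_of_nodup hn]
    refine Finset.card_le_card fun j hj => ?_
    simp only [Finset.mem_filter, Finset.mem_univ, true_and] at hj
    simp [othersList, mem_orderList, hj.1, hxt.trans_lt hj.2]
  have h3 : ∑ m, (runList s ((othersList v i).filter (fun a => decide (x < v a)))
      (fun _ => none, k)).2 m = 0 := by
    rw [h1]
    have := h.trans h2
    simp only
    omega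
  have h4 := (Finset.sum_eq_zero_iff.1 h3) l (Finset.mem_univ _)
  rw [openValues, Set.mem_ofPred_eq] at hx
  omega

theorem notMem_filter_othersList (v : Fin n → ℝ) (i : Fin n) (q : Fin n → Bool) :
    i ∉ (othersList v i).filter q := by
  simp [othersList]

theorem mem_firstChoice_update_self [NeZero p] {k : Fin p → ℕ} {s : Fin n → PrefList p}
    {v : Fin n → ℝ} {i : Fin n} {x : ℝ} (hx : Function.Injective (Function.update v i x)) :
    i ∈ firstChoice s (stableAlgorithm k (Function.update v i x) s) ↔
      x ∈ openValues k s v i (s i 0) := by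
  rw [stableAlgorithm_eq, orderList_update hx]
  simp only [firstChoice, Finset.mem_filter, Finset.mem_univ, true_and]
  rw [fst_runList_append_cons _ _ _ _ (notMem_filter_othersList _ _ _)
    (notMem_filter_othersList _ _ _) rfl, choice_eq_first_iff]
  rfl

/-- The decoupling step: the right-hand side does not involve `x`. The slot of `i` can be reserved
from the start, after which the position of `i` in the order is irrelevant. -/
theorem mem_firstChoice_update_of_ne [NeZero p] {k : Fin p → ℕ} {s : Fin n → PrefList p}
    {v : Fin n → ℝ} {i j : Fin n} {x : ℝ} (hx : Function.Injective (Function.update v i x))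
    (hopen : x ∈ openValues k s v i (s i 0)) (hj : j ≠ i) :
    j ∈ firstChoice s (stableAlgorithm k (Function.update v i x) s) ↔
      j ∈ firstChoice s (runList s (othersList v i)
        (fun _ => none, Function.update k (s i 0) (k (s i 0) - 1))).1 := by
  rw [stableAlgorithm_eq, orderList_update hx]
  simp only [firstChoice, Finset.mem_filter, Finset.mem_univ, true_and]
  rw [fst_runList_insert _ _ _ _ (choice_eq_first_iff.2 hopen) hj,
    ← List.eq_filter_append_filter v x _ (pairwise_othersList v i)]

theorem mem_firstChoice_of_forall_lt [NeZero p] {k : Fin p → ℕ} (hk : ∀ l, 1 ≤ k l)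
    {s : Fin n → PrefList p} {v : Fin n → ℝ} {a : Fin n} (ha : ∀ j, j ≠ a → v j < v a) :
    a ∈ firstChoice s (stableAlgorithm k v s) := by
  rw [stableAlgorithm_eq]
  simp only [firstChoice, Finset.mem_filter, Finset.mem_univ, true_and]
  have hmem := mem_orderList v a
  have hp := pairwise_orderList v
  have hn := nodup_orderList v
  cases hl : orderList v with
  | nil => simp [hl] at hmem
  | cons b l =>
    rw [hl] at hmem hp hn
    rw [List.pairwise_cons] at hp
    have hab : a = b := by
      rcases List.mem_cons.1 hmem with h | h
      · exact h
      · by_contra hne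
        exact absurd (hp.1 a h) (not_le.2 (ha b (Ne.symm hne)))
    subst hab
    have := fst_runList_append_cons s [] l (fun _ => none, k) (i := a) (by simp)
      (List.nodup_cons.1 hn).1 rfl
    rw [List.nil_append] at this
    rw [this, choice_eq_first_iff]
    exact hk _

/-! ### Relabelling the candidates -/

/-- Injectivity matters: ties are broken by index, which is not invariant under relabelling. -/
theorem orderList_comp {v : Fin n → ℝ} (hv : Function.Injective v) (e : Equiv.Perm (Fin n)) :
    orderList (v ∘ e) = (orderList v).map e.symm := by
  symm
  refine eq_orderList (hv.comp e.injective) ((nodup_orderList v).map e.symm.injective) ?_ ?_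
  · intro a
    rw [List.mem_map]
    exact ⟨e a, mem_orderList _ _, by simp⟩
  · rw [List.pairwise_map]
    simpa using pairwise_orderList v

theorem runList_comp (e : Equiv.Perm (Fin n)) (s : Fin n → PrefList p) (l : List (Fin n))
    (M : Selection n p) (c : Fin p → ℕ) :
    runList (s ∘ e) (l.map e.symm) (M ∘ e, c) =
      ((runList s l (M, c)).1 ∘ e, (runList s l (M, c)).2) := by
  induction l generalizing M c with
  | nil => rfl
  | cons a l ih =>
    rw [List.map_cons, runList_cons, runList_cons]
    cases h : choice c (s a) with
    | none =>
      rw [stableStep_of_none (st := (M, c)) h, stableStep_of_none (by simpa using h), ih]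
    | some m =>
      rw [stableStep_of_some (st := (M, c)) h, stableStep_of_some (l := m) (by simpa using h), ← ih]
      congr 2
      ext1 j
      by_cases hj : e j = a
      · subst hj; simp
      · have : j ≠ e.symm a := fun h => hj (by simp [h])
        simp [hj, this]

theorem mem_firstChoice_iff [NeZero p] {s : Fin n → PrefList p} {M : Selection n p} {j : Fin n} :
    j ∈ firstChoice s M ↔ M j = some (s j 0) := by
  simp [firstChoice]

theorem mem_firstChoice_comp [NeZero p] {k : Fin p → ℕ} {s : Fin n → PrefList p} {v : Fin n → ℝ}
    (hv : Function.Injective v) (e : Equiv.Perm (Fin n)) (j : Fin n) :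
    j ∈ firstChoice (s ∘ e) (stableAlgorithm k (v ∘ e) (s ∘ e)) ↔
      e j ∈ firstChoice s (stableAlgorithm k v s) := by
  rw [stableAlgorithm_eq, orderList_comp hv]
  have := runList_comp e s (orderList v) (fun _ => none) k
  rw [show ((fun _ => none : Selection n p) ∘ e) = fun _ => none from rfl] at this
  rw [this]
  rw [mem_firstChoice_iff, mem_firstChoice_iff, stableAlgorithm_eq]
  rfl

/-! ### Measurability -/

theorem measurable_decOrder : Measurable (decOrder : (Fin n → ℝ) → Equiv.Perm (Fin n)) := by
  refine measurable_to_countable' fun σ => ?_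
  have : decOrder ⁻¹' {σ} = ⋂ i, ⋂ j, {v : Fin n → ℝ | i ≤ j → v (σ j) ≤ v (σ i)} ∩
      {v | i < j → v (σ i) = v (σ j) → σ i < σ j} := by
    ext v
    rw [Set.mem_preimage, Set.mem_singleton_iff, eq_comm, decOrder, Tuple.eq_sort_iff]
    simp [Monotone, forall_and]
  rw [this]
  refine MeasurableSet.iInter fun i => MeasurableSet.iInter fun j => MeasurableSet.inter ?_ ?_
  · by_cases h : i ≤ j
    · simp only [h, forall_const]
      exact measurableSet_le (by fun_prop) (by fun_prop)
    · simp [h]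
  · by_cases h' : σ i < σ j
    · simp [h']
    by_cases h : i < j
    · simp only [h, h', forall_const, imp_false]
      exact (measurableSet_eq_fun (by fun_prop) (by fun_prop)).compl
    · simp [h]

theorem measurable_estimated (G₁ : Finset (Fin n)) (β : ℝ) : Measurable (estimated G₁ β) := by
  refine measurable_pi_lambda _ fun i => ?_
  unfold estimated
  split <;> fun_prop

instance : DiscreteMeasurableSpace (PrefList p) := ⟨fun _ => trivial⟩

/-- The outcome of the stable assignment is a function of the order of the candidates. -/
theorem measurable_stable_comp {E : Type*} [MeasurableSpace E] (k : Fin p → ℕ)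
    (G₁ : Finset (Fin n)) (β : ℝ) (F : (Fin n → PrefList p) → Selection n p → E) :
    Measurable fun w : (Fin n → ℝ) × (Fin n → PrefList p) =>
      F w.2 (stableAlgorithm k (estimated G₁ β w.1) w.2) := by
  have h1 : Measurable fun w : (Fin n → ℝ) × (Fin n → PrefList p) =>
      (decOrder (estimated G₁ β w.1), w.2) :=
    (measurable_decOrder.comp ((measurable_estimated G₁ β).comp measurable_fst)).prodMk
      measurable_snd
  have h2 : Measurable fun z : Equiv.Perm (Fin n) × (Fin n → PrefList p) =>
      F z.2 (runList z.2 ((List.finRange n).map z.1) (fun _ => none, k)).1 := .of_discrete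
  exact h2.comp h1

theorem continuous_topSum {k : ℕ} (hkn : k ≤ n) :
    Continuous (topSum k : (Fin n → ℝ) → ℝ) := by
  rw [continuous_iff_continuousAt]
  intro v
  rw [ContinuousAt, tendsto_iff_dist_tendsto_zero]
  refine squeeze_zero (fun _ => dist_nonneg) (fun w => abs_topSum_sub_le hkn w v) ?_
  have : Continuous fun w : Fin n → ℝ => ∑ i, |w i - v i| := by fun_prop
  simpa using this.tendsto v

end

/-! ### Tails of log-concave distributions. -/

noncomputable section

/-- The probability of a value larger than `x`. -/
def tail (D : Measure ℝ) (x : ℝ) : ℝ := D.real (Set.Ioi x)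

/-- The integrals of `h` over `(0, b]`, `(b, a]` and `(a, ∞)` are zero, negative and positive; each
interval contains a point of the corresponding sign. -/
theorem exists_signs {h : ℝ → ℝ} {a b : ℝ} (hb : 0 < b) (hab : b < a)
    (hint : IntegrableOn h (Set.Ioi 0)) (h0 : ∫ x in Set.Ioi 0, h x = 0)
    (h1 : ∫ x in Set.Ioi b, h x = 0) (h2 : 0 < ∫ x in Set.Ioi a, h x) :
    ∃ z x y, 0 < z ∧ z < x ∧ x < y ∧ 0 ≤ h z ∧ h x < 0 ∧ 0 < h y := by
  have key : ∀ c d, 0 ≤ c → c < d →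
      ∫ x in Set.Ioc c d, h x = (∫ x in Set.Ioi c, h x) - ∫ x in Set.Ioi d, h x := by
    intro c d hc hcd
    have hic : IntegrableOn h (Set.Ioi c) := hint.mono_set (Set.Ioi_subset_Ioi hc)
    rw [eq_sub_iff_add_eq, ← setIntegral_union, Set.Ioc_union_Ioi_eq_Ioi hcd.le]
    · exact Set.disjoint_left.2 fun x hx hx' => absurd hx.2 (not_le.2 hx')
    · exact measurableSet_Ioi
    · exact hic.mono_set Set.Ioc_subset_Ioi_self
    · exact hint.mono_set (Set.Ioi_subset_Ioi (hc.trans hcd.le))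
  have hvol : ∀ c d : ℝ, c < d → volume (Set.Ioc c d) ≠ 0 := by
    intro c d hcd
    simp [hcd]
  have hfin : ∀ c d : ℝ, volume (Set.Ioc c d) ≠ ⊤ := fun c d => by simp
  have hi : ∀ c d, 0 ≤ c → IntegrableOn h (Set.Ioc c d) := fun c d hc =>
    hint.mono_set (Set.Ioc_subset_Ioi_self.trans (Set.Ioi_subset_Ioi hc))
  obtain ⟨z, hz, hz'⟩ := exists_setAverage_le (hvol 0 b hb) (hfin 0 b) (hi 0 b le_rfl)
  obtain ⟨x, hx, hx'⟩ := exists_le_setAverage (hvol b a hab) (hfin b a) (hi b a hb.le)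
  rw [setAverage_eq, key 0 b le_rfl hb, h0, h1] at hz'
  rw [setAverage_eq, key b a hb.le hab, h1] at hx'
  obtain ⟨y, hy, hy'⟩ : ∃ y ∈ Set.Ioi a, 0 < h y := by
    by_contra! hall
    exact absurd (setIntegral_nonpos measurableSet_Ioi hall) (not_le.2 h2)
  refine ⟨z, x, y, hz.1, hz.2.trans_lt hx.1, hx.2.trans_lt hy, by simpa using hz', ?_, hy'⟩
  refine hx'.trans_lt ?_
  rw [zero_sub, smul_eq_mul]
  have : 0 < (volume.real (Set.Ioc b a))⁻¹ := by
    rw [Real.volume_real_Ioc_of_le hab.le]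
    exact inv_pos.2 (by linarith)
  nlinarith

theorem IsProbabilityMeasure.of_hasLogConcaveDensity {D : Measure ℝ}
    (hD : HasLogConcaveDensity D) : IsProbabilityMeasure D := by
  obtain ⟨f, hf, h0, -, h1, -, rfl⟩ := hD
  have hint : Integrable f := by
    by_contra h
    rw [integral_undef h] at h1
    exact zero_ne_one h1
  constructor
  rw [withDensity_apply _ MeasurableSet.univ, Measure.restrict_univ,
    ← ofReal_integral_eq_lintegral_ofReal hint (ae_of_all _ h0), h1, ENNReal.ofReal_one]

theorem nullMeasure_of_hasLogConcaveDensity {D : Measure ℝ} (hD : HasLogConcaveDensity D) :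
    D ≪ volume := by
  obtain ⟨f, hf, h0, -, h1, -, rfl⟩ := hD
  exact withDensity_absolutelyContinuous _ _

theorem nullSingletonClass_of_hasLogConcaveDensity {D : Measure ℝ} (hD : HasLogConcaveDensity D) :
    NullSingletonClass D :=
  ⟨fun x => nullMeasure_of_hasLogConcaveDensity hD (measure_singleton x)⟩

theorem ae_mem_Icc_of_hasLogConcaveDensity {D : Measure ℝ} (hD : HasLogConcaveDensity D) :
    ∀ᵐ x ∂D, x ∈ Set.Icc (0 : ℝ) 1 := by
  obtain ⟨f, hf, h0, h01, h1, -, rfl⟩ := hD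
  rw [ae_withDensity_iff (by fun_prop)]
  refine ae_of_all _ fun x hx => ?_
  by_contra h
  exact hx (by simp [h01 x h])

theorem tail_zero {D : Measure ℝ} (hD : HasLogConcaveDensity D) : tail D 0 = 1 := by
  have := IsProbabilityMeasure.of_hasLogConcaveDensity hD
  have := nullSingletonClass_of_hasLogConcaveDensity hD
  have h : Set.Ioi (0 : ℝ) =ᵐ[D] Set.univ := by
    have h2 : ∀ᵐ x ∂D, x ≠ 0 := by simp [ae_iff]
    filter_upwards [ae_mem_Icc_of_hasLogConcaveDensity hD, h2] with x hx hx0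
    simp only [eq_iff_iff]
    exact ⟨fun _ => trivial, fun _ => lt_of_le_of_ne hx.1 (Ne.symm hx0)⟩
  rw [tail, measureReal_congr h, probReal_univ]

theorem tail_one {D : Measure ℝ} (hD : HasLogConcaveDensity D) : tail D 1 = 0 := by
  have := IsProbabilityMeasure.of_hasLogConcaveDensity hD
  rw [tail, measureReal_eq_zero_iff]
  refine measure_mono_null (fun x hx => ?_) (ae_iff.1 (ae_mem_Icc_of_hasLogConcaveDensity hD))
  simp only [Set.mem_Icc, not_and, not_le]
  exact fun _ => hx

theorem tail_anti (D : Measure ℝ) [IsFiniteMeasure D] {x y : ℝ} (h : x ≤ y) :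
    tail D y ≤ tail D x :=
  measureReal_mono (Set.Ioi_subset_Ioi h)

theorem tail_nonneg (D : Measure ℝ) (x : ℝ) : 0 ≤ tail D x := measureReal_nonneg

theorem tail_le_one (D : Measure ℝ) [IsProbabilityMeasure D] (x : ℝ) : tail D x ≤ 1 :=
  measureReal_le_one

theorem continuous_tail (D : Measure ℝ) [IsProbabilityMeasure D] [NullSingletonClass D] :
    Continuous (tail D) := by
  have h : tail D = fun x => 1 - ProbabilityTheory.cdf D x := by
    ext x
    rw [ProbabilityTheory.cdf_eq_real, tail, ← Set.compl_Iic,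
      probReal_compl_eq_one_sub measurableSet_Iic]
  rw [h]
  refine continuous_const.sub ?_
  rw [continuous_iff_continuousAt]
  intro x
  rw [continuousAt_iff_continuous_left_right]
  refine ⟨?_, (ProbabilityTheory.cdf D).right_continuous x⟩
  have h1 := (ProbabilityTheory.cdf D).measure_singleton x
  rw [ProbabilityTheory.measure_cdf, measure_singleton] at h1
  have h2 := ENNReal.ofReal_eq_zero.1 h1.symm
  have h3 := (ProbabilityTheory.cdf D).mono.leftLim_le (le_refl x)
  have h4 := (ProbabilityTheory.cdf D).mono.tendsto_leftLim x
  rw [le_antisymm h3 (by linarith)] at h4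
  exact continuousWithinAt_Iio_iff_Iic.1 h4

/-- A distribution with a log-concave density has an increasing failure rate on average. -/
theorem tail_div_le {D : Measure ℝ} (hD : HasLogConcaveDensity D) {x β : ℝ} (hx : 0 ≤ x)
    (hβ : 0 < β) (hβ1 : β ≤ 1) : tail D (x / β) ≤ tail D x ^ (1 / β) := by
  have hprob := IsProbabilityMeasure.of_hasLogConcaveDensity hD
  have hz := tail_zero hD
  rcases hx.eq_or_lt with rfl | hx
  · rw [zero_div, hz, Real.one_rpow]
  rcases hβ1.eq_or_lt with rfl | hβ1
  · simp
  by_contra! hlt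
  set a := x / β with ha
  have hxa : x < a := by rw [ha, lt_div_iff₀ hβ]; nlinarith
  have hSx0 : 0 < tail D x := by
    rcases (tail_nonneg D x).eq_or_lt with h | h
    · have := tail_anti D hxa.le
      rw [← h] at this hlt
      have := Real.rpow_nonneg (le_refl (0 : ℝ)) (1 / β)
      linarith
    · exact h
  have hSx1 : tail D x < 1 := by
    rcases (tail_le_one D x).eq_or_lt with h | h
    · rw [h, Real.one_rpow] at hlt
      exact absurd (tail_le_one D a) (not_le.2 hlt)
    · exact h
  -- The rate of the exponential law whose tail agrees with that of `D` at `x`, as it also does at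
  -- `0`. If the claim fails, the tail of `D` is larger at `a`.
  set r := -Real.log (tail D x) / x with hr
  have hr0 : 0 < r := div_pos (neg_pos.2 (Real.log_neg hSx0 hSx1)) hx
  have hSx : tail D x = Real.exp (-r * x) := by
    rw [hr, ← neg_div, neg_neg, div_mul_cancel₀ _ hx.ne', Real.exp_log hSx0]
  have hSa : Real.exp (-r * a) < tail D a := by
    rw [hSx, ← Real.exp_mul] at hlt
    rwa [mul_one_div, mul_div_assoc, ← ha] at hlt
  obtain ⟨f, hf, hf0, hf01, hf1, hlc, hDf⟩ := hD
  have hint : Integrable f := by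
    by_contra h
    rw [integral_undef h] at hf1
    exact zero_ne_one hf1
  have htail : ∀ c, tail D c = ∫ y in Set.Ioi c, f y := by
    intro c
    rw [tail, Measure.real, hDf, withDensity_apply _ measurableSet_Ioi,
      ← ofReal_integral_eq_lintegral_ofReal hint.integrableOn (ae_of_all _ hf0),
      ENNReal.toReal_ofReal (setIntegral_nonneg measurableSet_Ioi fun y _ => hf0 y)]
  have hgi : ∀ c, IntegrableOn (fun y => r * Real.exp (-r * y)) (Set.Ioi c) := fun c =>
    (integrableOn_exp_mul_Ioi (by linarith) c).const_mul r
  have hg : ∀ c, ∫ y in Set.Ioi c, r * Real.exp (-r * y) = Real.exp (-r * c) := by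
    intro c
    rw [integral_const_mul, integral_exp_mul_Ioi (by linarith)]
    field_simp
  have hh : ∀ c, ∫ y in Set.Ioi c, (f y - r * Real.exp (-r * y)) =
      tail D c - Real.exp (-r * c) := by
    intro c
    rw [integral_sub hint.integrableOn (hgi c), hg, htail]
  -- The difference of the densities is nonnegative, negative, positive at `z < w < y`. This
  -- contradicts log-concavity of `f`, because the exponential density is log-linear and
  -- interpolates with equality.
  obtain ⟨z, w, y, hz0, hzw, hwy, hhz, hhw, hhy⟩ := exists_signs hx hxa
    (h := fun y => f y - r * Real.exp (-r * y)) (hint.integrableOn.sub (hgi 0))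
    (by rw [hh, hz]; simp) (by rw [hh, hSx]; simp) (by rw [hh]; linarith)
  have hpos : ∀ y, 0 < r * Real.exp (-r * y) := fun y => by positivity
  have hy1 : y ∈ Set.Icc (0 : ℝ) 1 := by
    by_contra h
    have := hpos y
    rw [hf01 y h] at hhy
    linarith
  set t := (w - z) / (y - z) with ht
  have hyz : 0 < y - z := by linarith
  have ht0 : 0 ≤ t := div_nonneg (by linarith) hyz.le
  have ht1 : t ≤ 1 := by rw [ht, div_le_one hyz]; linarith
  have hw : (1 - t) * z + t * y = w := by
    have : t * (y - z) = w - z := by rw [ht]; field_simp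
    linarith
  have h1 := hlc z ⟨hz0.le, by linarith [hy1.2]⟩ y hy1 t ⟨ht0, ht1⟩
  rw [hw] at h1
  have h2 : (r * Real.exp (-r * z)) ^ (1 - t) * (r * Real.exp (-r * y)) ^ t ≤
      f z ^ (1 - t) * f y ^ t := by
    refine mul_le_mul (Real.rpow_le_rpow (hpos z).le (by linarith) (by linarith))
      (Real.rpow_le_rpow (hpos y).le (by linarith) ht0) (Real.rpow_nonneg (hpos y).le _)
      (Real.rpow_nonneg (hf0 z) _)
  have h3 : (r * Real.exp (-r * z)) ^ (1 - t) * (r * Real.exp (-r * y)) ^ t =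
      r * Real.exp (-r * w) := by
    rw [Real.mul_rpow hr0.le (Real.exp_pos _).le, Real.mul_rpow hr0.le (Real.exp_pos _).le,
      mul_mul_mul_comm, ← Real.rpow_add hr0, ← Real.exp_mul, ← Real.exp_mul, ← Real.exp_add,
      ← hw, sub_add_cancel, Real.rpow_one]
    ring_nf
  linarith

/-! ### The ratio of the groups in the large-market limit -/

theorem log_le_self_div_two {s : ℝ} (hs : 2 ≤ s) : 2 * Real.log s ≤ s := by
  have h := Real.add_one_le_exp (Real.log (s / 2))
  have he := Real.exp_log (show 0 < s / 2 by linarith)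
  have h2 := Real.log_two_lt_d9
  rw [Real.log_div (by linarith) (by norm_num)] at h
  rw [Real.log_div (by linarith) (by norm_num)] at he
  linarith

theorem two_mul_log_div_le_one {s : ℝ} (hs : 2 ≤ s) : 2 * Real.log s / s ≤ 1 := by
  rw [div_le_one (by linarith)]
  exact log_le_self_div_two hs

theorem log_two_le {s : ℝ} (hs : 2 ≤ s) : 0.69 ≤ Real.log s := by
  have h2 := Real.log_two_gt_d9
  have := Real.log_le_log (by norm_num) hs
  linarith

theorem log_two_mul_log_ge {s : ℝ} (hs : 2 ≤ s) : (0.27 : ℝ) ≤ Real.log (2 * Real.log s) := by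
  have hL := log_two_le hs
  have h1 := Real.one_sub_inv_le_log_of_pos (show 0 < 2 * Real.log s by linarith)
  have h2 : (2 * Real.log s)⁻¹ ≤ 0.73 := by
    rw [inv_le_comm₀ (by linarith) (by norm_num)]
    norm_num
    linarith
  linarith

/-- The ratio `2 * log s / s` exceeds the positive root of `w * (1 + w) ^ (s - 1) = 1`. -/
theorem one_le_mul_rpow {s : ℝ} (hs : 2 ≤ s) :
    1 ≤ (2 * Real.log s / s) * (1 + 2 * Real.log s / s) ^ (s - 1) := by
  set T := Real.log s with hT
  have hT0 : 0.69 ≤ T := log_two_le hs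
  have hTs : 2 * T ≤ s := log_le_self_div_two hs
  have hs0 : 0 < s := by linarith
  have hw : 0 < 2 * T / s := div_pos (by linarith) hs0
  -- In logarithms the claim is `T - log (2 * T) ≤ (s - 1) * log (1 + 2 * T / s)`, and `log (1 + w)`
  -- is at least `2 * w / (w + 2)`.
  rw [← Real.log_nonneg_iff (by positivity), Real.log_mul hw.ne' (by positivity),
    Real.log_rpow (by linarith), Real.log_div (by linarith) hs0.ne']
  have h1 := Real.le_log_one_add_of_nonneg hw.le
  have h2 : 2 * (2 * T / s) / (2 * T / s + 2) = 2 * T / (T + s) := by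
    field_simp
  rw [h2] at h1
  have h3 := log_two_mul_log_ge hs
  rw [← hT] at h3 ⊢
  have h4 : (s - 1) * (2 * T / (T + s)) ≤ (s - 1) * Real.log (1 + 2 * T / s) :=
    mul_le_mul_of_nonneg_left h1 (by linarith)
  have h5 : T - 0.27 ≤ (s - 1) * (2 * T / (T + s)) := by
    rw [← mul_div_assoc, le_div_iff₀ (by linarith)]
    have h6 : T ≤ s - 2 + 0.6932 := by
      have h := Real.add_one_le_exp (Real.log (s / 2))
      have he := Real.log_le_sub_one_of_pos (show 0 < s / 2 by linarith)
      have h2 := Real.log_two_lt_d9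
      rw [Real.log_div (by linarith) (by norm_num)] at he
      linarith
    nlinarith
  linarith

/-- For `z ≤ 1 / 4` the ratio `z ^ (s - 1)` is only half of the target `2 * log s / s`; the spare
factor pays for replacing `z` by `z - d`. -/
theorem four_rpow_le {s : ℝ} (hs : 2 ≤ s) : (1 / 4 : ℝ) ^ (s - 1) ≤ Real.log s / s := by
  have h1 := one_add_mul_self_le_rpow_one_add (s := 3) (by norm_num) (p := s - 1) (by linarith)
  have hL := log_two_le hs
  rw [one_div, Real.inv_rpow (by norm_num), inv_le_comm₀ (by positivity)
    (div_pos (by linarith) (by linarith)), inv_div, div_le_iff₀ (by linarith)]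
  norm_num at h1
  nlinarith

/-- For `e = 0` the extremal case has both constraints tight: `y = w * z`, `z = 1 / (1 + w)` and `w
* (1 + w) ^ (s - 1) = 1`. Below `1 / (1 + w)` the power bound suffices; above it the bound on the
sum does, with `e ≤ 2 * e * z` since `z ≥ 1 / 2`. -/
theorem le_mul_of_le_rpow {s y z e : ℝ} (hs : 2 ≤ s) (hz : 0 ≤ z) (he : 0 ≤ e)
    (hyz : y ≤ z ^ s) (hsum : y + z ≤ 1 + e) : y ≤ (2 * Real.log s / s + 2 * e) * z := by
  set w := 2 * Real.log s / s with hw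
  have hw1 : w ≤ 1 := two_mul_log_div_le_one hs
  have hw0 : 0 < w := div_pos (by linarith [log_two_le hs]) (by linarith)
  have hkey : 1 ≤ w * (1 + w) ^ (s - 1) := one_le_mul_rpow hs
  rcases le_or_gt z (1 / (1 + w)) with h | h
  · rcases hz.eq_or_lt with rfl | hz
    · rw [Real.zero_rpow (by linarith)] at hyz
      simpa using hyz
    have h1 : z ^ (s - 1) ≤ w := by
      calc z ^ (s - 1) ≤ (1 / (1 + w)) ^ (s - 1) := Real.rpow_le_rpow hz.le h (by linarith)
        _ = 1 / (1 + w) ^ (s - 1) := by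
          rw [Real.div_rpow (by norm_num) (by linarith), Real.one_rpow]
        _ ≤ w := by
          rw [div_le_iff₀ (by positivity)]
          exact hkey
    have h2 : z ^ s = z ^ (s - 1) * z := by
      rw [Real.rpow_sub_one hz.ne', div_mul_cancel₀ _ hz.ne']
    rw [h2] at hyz
    nlinarith
  · have h1 : 1 ≤ (1 + w) * z := by
      rw [div_lt_iff₀ (by linarith)] at h
      linarith
    have h2 : 1 / 2 ≤ z := by nlinarith
    nlinarith

/-- Comparison of the two groups below the level that a fraction `d` exceeds. -/
theorem le_mul_sub_add {s y z e d : ℝ} (hs : 2 ≤ s) (hz : d ≤ z) (hz1 : z ≤ 1) (he : 0 ≤ e)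
    (hd : 0 ≤ d) (hyz : y ≤ z ^ s) (hsum : y + z ≤ 1 + e) :
    y ≤ (2 * Real.log s / s + 2 * e) * (1 + 8 * d) * (z - d) + 4 * d ^ 2 := by
  set w := 2 * Real.log s / s with hw
  have hw0 : 0 < w := div_pos (by linarith [log_two_le hs]) (by linarith)
  have hz0 : 0 ≤ z := hd.trans hz
  have hc : 0 ≤ (w + 2 * e) * (1 + 8 * d) * (z - d) :=
    mul_nonneg (by positivity) (by linarith)
  have hcw : w * (z - d) ≤ (w + 2 * e) * (1 + 8 * d) * (z - d) := by
    refine mul_le_mul_of_nonneg_right ?_ (by linarith)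
    nlinarith [mul_nonneg hw0.le hd, mul_nonneg he hd]
  -- For `z ≤ 2 * d` the term `4 * d ^ 2` alone suffices, as `s ≥ 2`. Otherwise `z ≤ 2 * (z - d)`.
  rcases le_or_gt z (2 * d) with h | h
  · have h1 : z ^ s ≤ z ^ 2 := by
      rw [← Real.rpow_natCast z 2]
      rcases hz0.eq_or_lt with rfl | hz0
      · rw [Real.zero_rpow (by linarith), Real.zero_rpow (by norm_num)]
      · exact Real.rpow_le_rpow_of_exponent_ge hz0 hz1 (by exact_mod_cast hs)
    nlinarith
  have hzp : 0 < z := by linarith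
  rcases le_or_gt z (1 / 4) with h4 | h4
  · have h1 : z ^ (s - 1) ≤ Real.log s / s :=
      (Real.rpow_le_rpow hz0 h4 (by linarith)).trans (four_rpow_le hs)
    have h2 : z ^ s = z ^ (s - 1) * z := by
      rw [Real.rpow_sub_one hzp.ne', div_mul_cancel₀ _ hzp.ne']
    have h3 : Real.log s / s = w / 2 := by rw [hw]; ring
    rw [h2] at hyz
    rw [h3] at h1
    nlinarith [sq_nonneg d]
  · have h1 := le_mul_of_le_rpow hs hz0 he hyz hsum
    -- Here `8 * d * (z - d) ≥ 4 * d * z ≥ d`.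
    have h2 : z ≤ (1 + 8 * d) * (z - d) := by nlinarith
    have h3 : (w + 2 * e) * z ≤ (w + 2 * e) * ((1 + 8 * d) * (z - d)) :=
      mul_le_mul_of_nonneg_left h2 (by positivity)
    nlinarith [sq_nonneg d]

end

/-! ### Product laws: resampling, absence of ties, level probabilities. -/

noncomputable section

variable {n : ℕ}

/-- Resampling coordinate `i` independently keeps the law, so expectations may be computed by
averaging over that coordinate first. -/
theorem measurePreserving_update {X : Type*} [MeasurableSpace X] (D : Measure X)
    [IsProbabilityMeasure D] (i : Fin n) :
    MeasurePreserving (fun z : (Fin n → X) × X => Function.update z.1 i z.2)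
      ((Measure.pi fun _ : Fin n => D).prod D) (Measure.pi fun _ : Fin n => D) := by
  have hm : Measurable (fun z : (Fin n → X) × X => Function.update z.1 i z.2) := by
    refine measurable_pi_lambda _ fun j => ?_
    by_cases h : j = i
    · subst h; simpa using measurable_snd
    · simp only [ne_eq, h, not_false_eq_true, Function.update_of_ne]
      fun_prop
  refine ⟨hm, (Measure.pi_eq fun s hs => ?_).symm⟩
  rw [Measure.map_apply hm (MeasurableSet.univ_pi hs)]
  have : (fun z : (Fin n → X) × X => Function.update z.1 i z.2) ⁻¹' Set.univ.pi s =
      (Set.univ.pi (Function.update s i Set.univ)) ×ˢ s i := by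
    ext z
    simp only [Set.mem_preimage, Set.mem_pi, Set.mem_univ, forall_const, Set.mem_prod]
    constructor
    · refine fun h => ⟨fun j => ?_, by simpa using h i⟩
      by_cases hj : j = i
      · subst hj; simp
      · simpa [hj] using h j
    · rintro ⟨h1, h2⟩ j
      by_cases hj : j = i
      · subst hj; simpa using h2
      · simpa [hj] using h1 j
  rw [this, Measure.prod_prod, Measure.pi_pi]
  rw [← Finset.mul_prod_erase Finset.univ (fun j => D (s j)) (Finset.mem_univ i),
    ← Finset.mul_prod_erase Finset.univ _ (Finset.mem_univ i), Function.update_self, measure_univ,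
    one_mul, mul_comm]
  congr 1
  refine Finset.prod_congr rfl fun j hj => ?_
  rw [Function.update_of_ne (Finset.ne_of_mem_erase hj)]

/-- Given the other coordinates, a tie forces `u i` to be one particular point, which is null for
`D`. -/
theorem ae_ne_of_mul (D : Measure ℝ) [IsProbabilityMeasure D] [NullSingletonClass D] {i j : Fin n}
    (hij : i ≠ j) {a b : ℝ} (ha : a ≠ 0) :
    ∀ᵐ u ∂(Measure.pi fun _ : Fin n => D), a * u i ≠ b * u j := by
  have h := measurePreserving_update D i
  have hm : MeasurableSet {u : Fin n → ℝ | a * u i = b * u j} :=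
    measurableSet_eq_fun (by fun_prop) (by fun_prop)
  rw [ae_iff]
  simp only [ne_eq, not_not]
  rw [← h.measure_preimage hm.nullMeasurableSet, Measure.measure_prod_null (h.measurable hm)]
  refine ae_of_all _ fun u => ?_
  refine measure_mono_null (t := {b * u j / a}) (fun x hx => ?_) (measure_singleton _)
  simp only [Set.mem_preimage, Set.mem_ofPred_eq, Function.update_self,
    Function.update_of_ne hij.symm] at hx
  rw [Set.mem_singleton_iff, ← hx]
  field_simp

theorem estimated_apply (G : Finset (Fin n)) (β : ℝ) (u : Fin n → ℝ) (i : Fin n) :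
    estimated G β u i = (if i ∈ G then 1 else β) * u i := by
  unfold estimated
  split <;> simp

theorem ae_injective_estimated (D : Measure ℝ) [IsProbabilityMeasure D] [NullSingletonClass D]
    (G : Finset (Fin n)) {β : ℝ} (hβ : β ≠ 0) :
    ∀ᵐ u ∂(Measure.pi fun _ : Fin n => D), Function.Injective (estimated G β u) := by
  have h : ∀ᵐ u ∂(Measure.pi fun _ : Fin n => D), ∀ i j, i ≠ j →
      estimated G β u i ≠ estimated G β u j := by
    rw [ae_all_iff]; intro i
    rw [ae_all_iff]; intro j
    by_cases hij : i = j
    · simp [hij]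
    simp only [estimated_apply]
    filter_upwards [ae_ne_of_mul D hij (a := if i ∈ G then 1 else β)
      (b := if j ∈ G then 1 else β) (by split <;> simp [hβ])] with u hu _ using hu
  filter_upwards [h] with u hu i j hij
  by_contra hne
  exact hu i j hne hij

theorem ae_pi_of_ae (D : Measure ℝ) [IsProbabilityMeasure D] {P : ℝ → Prop} (h : ∀ᵐ x ∂D, P x) :
    ∀ᵐ u ∂(Measure.pi fun _ : Fin n => D), ∀ i, P (u i) := by
  rw [ae_all_iff]
  exact fun i => (measurePreserving_eval (fun _ : Fin n => D) i).quasiMeasurePreserving.ae h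

theorem estimated_update_of_notMem {G : Finset (Fin n)} {i : Fin n} (hi : i ∉ G) (β : ℝ)
    (u : Fin n → ℝ) (x : ℝ) :
    estimated G β (Function.update u i x) = Function.update (estimated G β u) i (β * x) := by
  ext j
  by_cases h : j = i
  · subst h; simp [estimated, hi]
  · simp [estimated, h]

theorem estimated_insert_update {G : Finset (Fin n)} {i : Fin n} (β : ℝ)
    (u : Fin n → ℝ) (x : ℝ) :
    estimated (insert i G) β (Function.update u i x) =
      Function.update (estimated G β u) i x := by
  ext j
  by_cases h : j = i
  · subst h; simp [estimated]
  · simp [estimated, h]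

/-- The chance to land in an up-set: group comparison. -/
theorem measureReal_openSet_le {D : Measure ℝ} (hD : HasLogConcaveDensity D) {U : Set ℝ}
    (hU : ∀ x ∈ U, ∀ y, x ≤ y → y ∈ U) {t lam β e : ℝ} (ht : 0 ≤ t) (hUt : ∀ x ∈ U, t < x)
    (hβ : 0 < β) (hβ2 : β ≤ 1 / 2) (he : 0 ≤ e) (hte : tail D t + tail D (t / β) ≤ 1 + e) :
    D.real {x | β * x ∈ U ∧ β * x ≤ lam} ≤
      (2 * β * Real.log (1 / β) + 2 * e) * (1 + 8 * tail D lam) *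
        D.real {x | x ∈ U ∧ x ≤ lam} + 4 * tail D lam ^ 2 := by
  have := IsProbabilityMeasure.of_hasLogConcaveDensity hD
  have := nullSingletonClass_of_hasLogConcaveDensity hD
  have hs : 2 ≤ 1 / β := by rw [le_div_iff₀ hβ]; linarith
  have hr : 2 * Real.log (1 / β) / (1 / β) = 2 * β * Real.log (1 / β) := by field_simp
  have hr0 : 0 ≤ 2 * β * Real.log (1 / β) :=
    mul_nonneg (by linarith) (Real.log_nonneg (by linarith))
  have hd0 : 0 ≤ tail D lam := tail_nonneg D lam
  have hrhs : 0 ≤ (2 * β * Real.log (1 / β) + 2 * e) * (1 + 8 * tail D lam) *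
        D.real {x | x ∈ U ∧ x ≤ lam} + 4 * tail D lam ^ 2 := by
    have : 0 ≤ D.real {x | x ∈ U ∧ x ≤ lam} := measureReal_nonneg
    positivity
  rcases U.eq_empty_or_nonempty with rfl | hne
  · refine le_trans (le_of_eq ?_) hrhs
    simp
  -- The up-set is a ray starting at `θ`, with or without its endpoint, which is null.
  set θ := sInf U with hθ
  have hbdd : BddBelow U := ⟨t, fun x hx => (hUt x hx).le⟩
  have htθ : t ≤ θ := le_csInf hne fun x hx => (hUt x hx).le
  have hsub1 : ∀ x, θ < x → x ∈ U := by
    intro x hx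
    obtain ⟨y, hy, hyx⟩ := exists_lt_of_csInf_lt hne hx
    exact hU y hy x hyx.le
  have hsub2 : ∀ x ∈ U, θ ≤ x := fun x hx => csInf_le hbdd hx
  rcases le_or_gt lam θ with h | h
  · refine le_trans (le_of_eq ?_) hrhs
    rw [measureReal_eq_zero_iff]
    -- Membership gives `θ ≤ β * x ≤ lam ≤ θ`.
    refine measure_mono_null (t := {lam / β}) (fun x hx => ?_) (measure_singleton _)
    have h1 := hsub2 _ hx.1
    have h2 := hx.2
    rw [Set.mem_singleton_iff, eq_div_iff hβ.ne']
    linarith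
  · have h1 : D.real {x | β * x ∈ U ∧ β * x ≤ lam} ≤ tail D (θ / β) := by
      rw [tail, ← measureReal_congr (Ioi_ae_eq_Ici (μ := D) (a := θ / β)).symm]
      refine measureReal_mono fun x hx => ?_
      have := hsub2 _ hx.1
      rw [Set.mem_Ici, div_le_iff₀ hβ]
      linarith
    have h2 : tail D θ - tail D lam ≤ D.real {x | x ∈ U ∧ x ≤ lam} := by
      have h3 : tail D θ = D.real (Set.Ioc θ lam) + tail D lam := by
        rw [tail, tail, ← Set.Ioc_union_Ioi_eq_Ioi h.le,
          measureReal_union _ measurableSet_Ioi]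
        exact Set.disjoint_left.2 fun x hx hx' => absurd hx.2 (not_le.2 hx')
      have h4 : D.real (Set.Ioc θ lam) ≤ D.real {x | x ∈ U ∧ x ≤ lam} :=
        measureReal_mono fun x hx => ⟨hsub1 x hx.1, hx.2⟩
      linarith
    have hθ0 : 0 ≤ θ := ht.trans htθ
    have hsum : tail D (θ / β) + tail D θ ≤ 1 + e := by
      have h5 := tail_anti D htθ
      have h6 := tail_anti D (div_le_div_of_nonneg_right htθ hβ.le)
      linarith
    have h7 := le_mul_sub_add hs (tail_anti D h.le) (tail_le_one D θ) he hd0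
      (tail_div_le hD hθ0 hβ (by linarith)) hsum
    rw [hr] at h7
    have h8 : (2 * β * Real.log (1 / β) + 2 * e) * (1 + 8 * tail D lam) *
        (tail D θ - tail D lam) ≤ (2 * β * Real.log (1 / β) + 2 * e) * (1 + 8 * tail D lam) *
        D.real {x | x ∈ U ∧ x ≤ lam} := mul_le_mul_of_nonneg_left h2 (by positivity)
    linarith

theorem exists_tail_eq {D : Measure ℝ} (hD : HasLogConcaveDensity D) {d : ℝ} (hd0 : 0 ≤ d)
    (hd1 : d ≤ 1) : ∃ x, 0 ≤ x ∧ tail D x = d := by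
  have := IsProbabilityMeasure.of_hasLogConcaveDensity hD
  have := nullSingletonClass_of_hasLogConcaveDensity hD
  have h := intermediate_value_Icc' (zero_le_one' ℝ) (continuous_tail D).continuousOn
  rw [tail_zero hD, tail_one hD] at h
  obtain ⟨x, hx, hx'⟩ := h ⟨hd0, hd1⟩
  exact ⟨x, hx.1, hx'⟩

theorem exists_tail_add_tail_eq {D : Measure ℝ} (hD : HasLogConcaveDensity D) {β d : ℝ}
    (hβ : 0 < β) (hβ1 : β ≤ 1) (hd0 : 0 ≤ d) (hd1 : d ≤ 2) :
    ∃ x, 0 ≤ x ∧ tail D x + tail D (x / β) = d := by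
  have := IsProbabilityMeasure.of_hasLogConcaveDensity hD
  have := nullSingletonClass_of_hasLogConcaveDensity hD
  have hc : Continuous fun x => tail D x + tail D (x / β) :=
    (continuous_tail D).add ((continuous_tail D).comp (continuous_id.div_const β))
  have h := intermediate_value_Icc' (zero_le_one' ℝ) hc.continuousOn
  have h1 : tail D (1 / β) = 0 :=
    le_antisymm ((tail_anti D (by rw [le_div_iff₀ hβ]; linarith)).trans_eq (tail_one hD))
      (tail_nonneg D _)
  simp only [zero_div, tail_zero hD, tail_one hD, h1, add_zero] at h
  obtain ⟨x, hx, hx'⟩ := h (show d ∈ Set.Icc (0 : ℝ) (1 + 1) from ⟨hd0, by linarith⟩)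
  exact ⟨x, hx.1, hx'⟩

theorem measureReal_pi_coord (D : Measure ℝ) [IsProbabilityMeasure D] (i : Fin n) {s : Set ℝ}
    (hs : MeasurableSet s) :
    (Measure.pi fun _ : Fin n => D).real {u | u i ∈ s} = D.real s :=
  (measurePreserving_eval (fun _ : Fin n => D) i).measureReal_preimage hs.nullMeasurableSet

theorem measureReal_forall_le (D : Measure ℝ) [IsProbabilityMeasure D] (G : Finset (Fin n))
    (lam : ℝ) :
    (Measure.pi fun _ : Fin n => D).real {u | ∀ j ∈ G, u j ≤ lam} = (1 - tail D lam) ^ G.card := by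
  have h1 : {u : Fin n → ℝ | ∀ j ∈ G, u j ≤ lam} =
      Set.univ.pi fun j => if j ∈ G then Set.Iic lam else Set.univ := by
    ext u
    simp only [Set.mem_ofPred_eq, Set.mem_pi, Set.mem_univ, forall_const]
    refine forall_congr' fun j => ?_
    by_cases hj : j ∈ G <;> simp [hj]
  have h2 : ∀ j, D (if j ∈ G then Set.Iic lam else Set.univ) =
      if j ∈ G then D (Set.Iic lam) else 1 := by
    intro j
    split <;> simp
  have h3 : D.real (Set.Iic lam) = 1 - tail D lam := by
    rw [tail, ← Set.compl_Iic, probReal_compl_eq_one_sub measurableSet_Iic]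
    ring
  rw [h1, Measure.real, Measure.pi_pi]
  simp only [h2]
  rw [Finset.prod_ite_mem, Finset.univ_inter, Finset.prod_const, ENNReal.toReal_pow, ← h3]
  rfl

theorem measureReal_exists_gt (D : Measure ℝ) [IsProbabilityMeasure D] (G : Finset (Fin n))
    {β : ℝ} (hβ : 0 < β) (lam : ℝ) :
    (Measure.pi fun _ : Fin n => D).real {u | ∃ j ∈ G, lam < β * u j} ≤
      G.card * tail D (lam / β) := by
  have h1 : {u : Fin n → ℝ | ∃ j ∈ G, lam < β * u j} =
      ⋃ j ∈ G, {u | u j ∈ Set.Ioi (lam / β)} := by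
    ext u
    simp [div_lt_iff₀ hβ, mul_comm]
  rw [h1]
  refine (measureReal_biUnion_finset_le _ _).trans ?_
  simp only [measureReal_pi_coord D _ measurableSet_Ioi]
  simp [tail]

/-- Hoeffding's bound for the number of candidates above the level `t`. -/
theorem measureReal_card_le (D : Measure ℝ) [IsProbabilityMeasure D] (G : Finset (Fin n)) {K : ℕ}
    (hG : G.card = K) (hG' : Gᶜ.card = K) {β t e : ℝ} (hβ : 0 < β) (he : 0 ≤ e)
    (hte : tail D t + tail D (t / β) = 1 + e) :
    (Measure.pi fun _ : Fin n => D).real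
      {u | (Finset.univ.filter fun j => t < estimated G β u j).card ≤ K} ≤
      Real.exp (-(K * e ^ 2)) := by
  rcases Nat.eq_zero_or_pos K with rfl | hK
  · simp
  set P := Measure.pi fun _ : Fin n => D
  set A : Fin n → Set ℝ := fun j => if j ∈ G then Set.Ioi t else Set.Ioi (t / β) with hA
  have hAm : ∀ j, MeasurableSet (A j) := fun j => by
    simp only [hA]; split <;> exact measurableSet_Ioi
  -- The sign turns too few candidates above the level into an upper-tail event. Each centred
  -- variable has sub-Gaussian parameter `1 / 4`, so the `2 * K` of them contribute `K / 2` and the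
  -- bound is `exp (-(K * e) ^ 2 / K)`.
  set X : Fin n → (Fin n → ℝ) → ℝ := fun j u => -(A j).indicator (fun _ => (1 : ℝ)) (u j) with hX
  have hXm : ∀ j, Measurable (X j) := fun j =>
    ((measurable_const.indicator (hAm j)).comp (measurable_pi_apply j)).neg
  have hX01 : ∀ j u, X j u ∈ Set.Icc (-1 : ℝ) 0 := by
    intro j u
    simp only [hX, Set.indicator]
    split <;> simp
  have hint : ∀ j, ∫ u, X j u ∂P = -D.real (A j) := by
    intro j
    rw [← measureReal_pi_coord D j (hAm j), integral_neg]
    congr 1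
    have hm : MeasurableSet {u : Fin n → ℝ | u j ∈ A j} :=
      (measurable_pi_apply (X := fun _ : Fin n => ℝ) j) (hAm j)
    rw [← integral_indicator_one hm]
    rfl
  have hind : ProbabilityTheory.iIndepFun (fun j u => X j u - ∫ u, X j u ∂P) P := by
    have := ProbabilityTheory.iIndepFun_pi (μ := fun _ : Fin n => D)
      (X := fun j x => -(A j).indicator (fun _ => (1 : ℝ)) x - ∫ u, X j u ∂P)
      fun j => ((measurable_const.indicator (hAm j)).neg.sub_const _).aemeasurable
    exact this
  have hsub : ∀ j ∈ Finset.univ, ProbabilityTheory.HasSubgaussianMGF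
      (fun u => X j u - ∫ u, X j u ∂P) ((‖(0 : ℝ) - (-1)‖₊ / 2) ^ 2) P := fun j _ =>
    ProbabilityTheory.hasSubgaussianMGF_of_mem_Icc (hXm j).aemeasurable (ae_of_all _ (hX01 j))
  have hH := ProbabilityTheory.HasSubgaussianMGF.measure_sum_ge_le_of_iIndepFun hind hsub
    (ε := K * e) (by positivity)
  have hn : n = K + K := by
    have := Finset.card_add_card_compl G
    rw [hG, hG', Fintype.card_fin] at this
    exact this.symm
  have hsum : ∑ j, D.real (A j) = K + K * e := by
    rw [← Finset.sum_add_sum_compl G]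
    have h1 : ∑ j ∈ G, D.real (A j) = K * tail D t := by
      have h : ∑ j ∈ G, D.real (A j) = ∑ j ∈ G, tail D t :=
        Finset.sum_congr rfl fun j hj => by simp [hA, hj, tail]
      rw [h, Finset.sum_const, hG, nsmul_eq_mul]
    have h2 : ∑ j ∈ Gᶜ, D.real (A j) = K * tail D (t / β) := by
      have h : ∑ j ∈ Gᶜ, D.real (A j) = ∑ j ∈ Gᶜ, tail D (t / β) :=
        Finset.sum_congr rfl fun j hj => by simp [hA, Finset.mem_compl.1 hj, tail]
      rw [h, Finset.sum_const, hG', nsmul_eq_mul]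
    rw [h1, h2, ← mul_add, hte]
    ring
  refine le_trans (measureReal_mono fun u hu => ?_) (hH.trans (le_of_eq ?_))
  · rw [Set.mem_ofPred_eq] at hu ⊢
    have h1 : ∑ j, X j u = -((Finset.univ.filter fun j => t < estimated G β u j).card : ℝ) := by
      rw [Finset.card_filter, Nat.cast_sum, ← Finset.sum_neg_distrib]
      refine Finset.sum_congr rfl fun j _ => ?_
      simp only [hX, hA, Set.indicator, estimated]
      by_cases hj : j ∈ G
      · simp [hj]
      · simp [hj, div_lt_iff₀ hβ, mul_comm]
    rw [Finset.sum_sub_distrib, h1, Finset.sum_congr rfl fun j _ => hint j,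
      Finset.sum_neg_distrib, hsum]
    have : ((Finset.univ.filter fun j => t < estimated G β u j).card : ℝ) ≤ K := by
      exact_mod_cast hu
    linarith
  · have hK' : (0 : ℝ) < K := by exact_mod_cast hK
    congr 1
    rw [Finset.sum_const, Finset.card_univ, Fintype.card_fin, hn]
    simp
    field_simp
    ring

end

/-! ### Weights and exchangeability. -/

noncomputable section

variable {n p : ℕ} [NeZero p]

/-- The candidates with estimated utility at most `lam` who obtain their first choice under the
stable assignment. -/
def lowChoice (k : Fin p → ℕ) (G : Finset (Fin n)) (β lam : ℝ)
    (w : (Fin n → ℝ) × (Fin n → PrefList p)) : Finset (Fin n) :=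
  (firstChoice w.2 (stableAlgorithm k (estimated G β w.1) w.2)).filter
    fun j => estimated G β w.1 j ≤ lam

/-- The weight of candidate `i` in the comparison with the candidates of `H`. -/
def lowWeight (k : Fin p → ℕ) (G H : Finset (Fin n)) (β lam : ℝ) (i : Fin n)
    (w : (Fin n → ℝ) × (Fin n → PrefList p)) : ℝ :=
  if i ∈ lowChoice k G β lam w then
    (1 + (((lowChoice k G β lam w ∩ H).erase i).card : ℝ))⁻¹ else 0

theorem lowWeight_mem_Icc (k : Fin p → ℕ) (G H : Finset (Fin n)) (β lam : ℝ) (i : Fin n)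
    (w : (Fin n → ℝ) × (Fin n → PrefList p)) : lowWeight k G H β lam i w ∈ Set.Icc (0 : ℝ) 1 := by
  unfold lowWeight
  split
  · refine ⟨by positivity, inv_le_one_of_one_le₀ ?_⟩
    have : (0 : ℝ) ≤ (((lowChoice k G β lam w ∩ H).erase i).card : ℝ) := by positivity
    linarith
  · simp

theorem measurableSet_mem_lowChoice (k : Fin p → ℕ) (G : Finset (Fin n)) (β lam : ℝ) (j : Fin n) :
    MeasurableSet {w : (Fin n → ℝ) × (Fin n → PrefList p) | j ∈ lowChoice k G β lam w} := by
  have h : {w : (Fin n → ℝ) × (Fin n → PrefList p) | j ∈ lowChoice k G β lam w} =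
      {w | j ∈ firstChoice w.2 (stableAlgorithm k (estimated G β w.1) w.2)} ∩
        {w | estimated G β w.1 j ≤ lam} := by
    ext w
    simp [lowChoice]
  rw [h]
  refine MeasurableSet.inter ?_ ?_
  · exact (measurable_stable_comp (E := Prop) k G β fun s M => j ∈ firstChoice s M).setOf
  · exact measurableSet_le
      ((measurable_pi_apply j).comp ((measurable_estimated G β).comp measurable_fst))
      measurable_const

theorem measurable_lowWeight (k : Fin p → ℕ) (G H : Finset (Fin n)) (β lam : ℝ) (i : Fin n) :
    Measurable (lowWeight k G H β lam i) := by
  have h : ∀ w, (((lowChoice k G β lam w ∩ H).erase i).card : ℝ) =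
      ∑ j ∈ H.erase i, if j ∈ lowChoice k G β lam w then (1 : ℝ) else 0 := by
    intro w
    rw [← Finset.sum_filter, Finset.sum_const, nsmul_eq_mul, mul_one]
    congr 2
    ext j
    simp only [Finset.mem_erase, Finset.mem_inter, Finset.mem_filter]
    tauto
  unfold lowWeight
  simp only [h]
  refine Measurable.ite (measurableSet_mem_lowChoice k G β lam i) ?_ measurable_const
  refine (measurable_const.add (Finset.measurable_sum _ fun j _ => ?_)).inv
  exact Measurable.ite (measurableSet_mem_lowChoice k G β lam j) measurable_const measurable_const

/-- For `i` in `A`, adding `1` restores the erased `i`, so each of the `|A|` successful members has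
weight `1 / |A|`; the sum is `1`, or `0` if `A` is empty. -/
theorem sum_lowWeight_le_one (k : Fin p → ℕ) (G : Finset (Fin n)) (β lam : ℝ)
    (w : (Fin n → ℝ) × (Fin n → PrefList p)) : ∑ i ∈ G, lowWeight k G G β lam i w ≤ 1 := by
  set A := lowChoice k G β lam w ∩ G with hA
  have h : ∀ i ∈ G, lowWeight k G G β lam i w = if i ∈ A then (A.card : ℝ)⁻¹ else 0 := by
    intro i hi
    unfold lowWeight
    by_cases hi' : i ∈ lowChoice k G β lam w
    · have hiA : i ∈ A := Finset.mem_inter.2 ⟨hi', hi⟩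
      rw [if_pos hi', if_pos hiA, ← Finset.card_erase_add_one hiA]
      push_cast
      rw [add_comm]
    · have hiA : i ∉ A := fun h => hi' (Finset.mem_inter.1 h).1
      rw [if_neg hi', if_neg hiA]
  rw [Finset.sum_congr rfl h, Finset.sum_ite_mem, Finset.sum_const, nsmul_eq_mul,
    Finset.inter_eq_right.2 Finset.inter_subset_right]
  exact mul_inv_le_one

theorem estimated_comp_swap {G : Finset (Fin n)} {i j : Fin n} (hi : i ∈ G) (hj : j ∈ G) (β : ℝ)
    (u : Fin n → ℝ) : estimated G β (u ∘ Equiv.swap i j) = estimated G β u ∘ Equiv.swap i j := by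
  have h : ∀ a, Equiv.swap i j a ∈ G ↔ a ∈ G := by
    intro a
    rw [Equiv.swap_apply_def]
    split_ifs with h1 h2
    · subst h1; simp [hi, hj]
    · subst h2; simp [hi, hj]
    · rfl
  ext a
  simp [estimated, h]

/-- The algorithm treats candidates anonymously, and a swap within `G` preserves the groups. -/
theorem lowWeight_comp_swap {k : Fin p → ℕ} {G : Finset (Fin n)} {i j : Fin n} (hi : i ∈ G)
    (hj : j ∈ G) {β lam : ℝ} {w : (Fin n → ℝ) × (Fin n → PrefList p)}
    (hw : Function.Injective (estimated G β w.1)) :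
    lowWeight k G G β lam i (w.1 ∘ Equiv.swap i j, w.2 ∘ Equiv.swap i j) =
      lowWeight k G G β lam j w := by
  set e := Equiv.swap i j with he
  have hG : ∀ a, e a ∈ G ↔ a ∈ G := by
    intro a
    rw [he, Equiv.swap_apply_def]
    split_ifs with h1 h2
    · subst h1; simp [hi, hj]
    · subst h2; simp [hi, hj]
    · rfl
  have hmem : ∀ a, a ∈ lowChoice k G β lam (w.1 ∘ e, w.2 ∘ e) ↔ e a ∈ lowChoice k G β lam w := by
    intro a
    simp only [lowChoice, Finset.mem_filter]
    rw [he, estimated_comp_swap hi hj, ← he, mem_firstChoice_comp hw]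
    rfl
  have hei : e i = j := Equiv.swap_apply_left i j
  have hcard : ((lowChoice k G β lam (w.1 ∘ e, w.2 ∘ e) ∩ G).erase i).card =
      ((lowChoice k G β lam w ∩ G).erase j).card := by
    rw [← Finset.card_map e.toEmbedding]
    congr 1
    ext a
    obtain ⟨b, rfl⟩ := e.surjective a
    simp only [Finset.mem_map_equiv, Equiv.symm_apply_apply, Finset.mem_erase, Finset.mem_inter,
      hmem, hG]
    rw [← hei, ne_eq, ne_eq, e.injective.eq_iff]
  unfold lowWeight
  rw [hcard]
  simp only [hmem, hei]

theorem measurePreserving_comp_perm {X : Type*} [MeasurableSpace X] (D : Measure X)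
    [IsProbabilityMeasure D] (e : Equiv.Perm (Fin n)) :
    MeasurePreserving (fun u : Fin n → X => u ∘ e) (Measure.pi fun _ : Fin n => D)
      (Measure.pi fun _ : Fin n => D) := by
  have h := measurePreserving_piCongrLeft (fun _ : Fin n => D) e.symm
  convert h using 1
  ext u a
  have := MeasurableEquiv.piCongrLeft_apply_apply (β := fun _ : Fin n => X) e.symm u (e a)
  simpa using this.symm

theorem ae_instanceLaw_of_ae {p : ℕ} (D : Measure ℝ) (L : Measure (PrefList p))
    {P : (Fin n → ℝ) → Prop} (h : ∀ᵐ u ∂(Measure.pi fun _ : Fin n => D), P u) :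
    ∀ᵐ w ∂(instanceLaw D L n), P w.1 :=
  Measure.quasiMeasurePreserving_fst.ae h

variable (D : Measure ℝ) (L : Measure (PrefList p)) [IsProbabilityMeasure D]
  [IsProbabilityMeasure L]

instance isProbabilityMeasure_instanceLaw : IsProbabilityMeasure (instanceLaw D L n) := by
  unfold instanceLaw; infer_instance

theorem integrable_lowWeight (k : Fin p → ℕ) (G H : Finset (Fin n)) (β lam : ℝ) (i : Fin n) :
    Integrable (lowWeight k G H β lam i) (instanceLaw D L n) :=
  Integrable.of_mem_Icc 0 1 (measurable_lowWeight k G H β lam i).aemeasurable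
    (ae_of_all _ fun w => lowWeight_mem_Icc k G H β lam i w)

theorem integral_lowWeight_swap [NullSingletonClass D] (k : Fin p → ℕ) {G : Finset (Fin n)}
    {β : ℝ} (hβ : β ≠ 0) (lam : ℝ) {i j : Fin n} (hi : i ∈ G) (hj : j ∈ G) :
    ∫ w, lowWeight k G G β lam i w ∂(instanceLaw D L n) =
      ∫ w, lowWeight k G G β lam j w ∂(instanceLaw D L n) := by
  have hmp : MeasurePreserving (fun w : (Fin n → ℝ) × (Fin n → PrefList p) =>
      (w.1 ∘ Equiv.swap i j, w.2 ∘ Equiv.swap i j)) (instanceLaw D L n) (instanceLaw D L n) :=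
    (measurePreserving_comp_perm D (Equiv.swap i j)).prod
      (measurePreserving_comp_perm L (Equiv.swap i j))
  have h1 := integral_map (μ := instanceLaw D L n) hmp.measurable.aemeasurable
    (f := lowWeight k G G β lam i)
    (measurable_lowWeight k G G β lam i).aestronglyMeasurable
  rw [hmp.map_eq] at h1
  rw [h1]
  refine integral_congr_ae ?_
  filter_upwards [ae_instanceLaw_of_ae D L (ae_injective_estimated D G hβ)] with w hw
  exact lowWeight_comp_swap hi hj hw

/-- By exchangeability, the expected weight of a member of `G` is at most `1 / |G|`. -/
theorem integral_lowWeight_le [NullSingletonClass D] (k : Fin p → ℕ) {G : Finset (Fin n)}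
    {β : ℝ} (hβ : β ≠ 0) (lam : ℝ) {i : Fin n} (hi : i ∈ G) :
    G.card * ∫ w, lowWeight k G G β lam i w ∂(instanceLaw D L n) ≤ 1 := by
  have h1 : ∑ j ∈ G, ∫ w, lowWeight k G G β lam j w ∂(instanceLaw D L n) ≤ 1 := by
    rw [← integral_finsetSum _ fun j _ => integrable_lowWeight D L k G G β lam j]
    calc _ ≤ ∫ w, (1 : ℝ) ∂(instanceLaw D L n) :=
          integral_mono (integrable_finsetSum _ fun j _ => integrable_lowWeight D L k G G β lam j)
            (integrable_const _) fun w => sum_lowWeight_le_one k G β lam w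
      _ = 1 := by simp
  rw [Finset.sum_congr rfl fun j hj => (integral_lowWeight_swap D L k hβ lam hi hj).symm,
    Finset.sum_const, nsmul_eq_mul] at h1
  exact h1

end

/-! ### Moving one candidate between the groups. -/

noncomputable section

variable {n p : ℕ}

theorem measurePreserving_instanceLaw_update (D : Measure ℝ) (L : Measure (PrefList p))
    [IsProbabilityMeasure D] [IsProbabilityMeasure L] (i : Fin n) :
    MeasurePreserving (fun z : ((Fin n → ℝ) × (Fin n → PrefList p)) × ℝ =>
      (Function.update z.1.1 i z.2, z.1.2)) ((instanceLaw D L n).prod D) (instanceLaw D L n) := by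
  have h1 := measurePreserving_prodAssoc (Measure.pi fun _ : Fin n => D)
    (Measure.pi fun _ : Fin n => L) D
  have h2 := (MeasurePreserving.id (Measure.pi fun _ : Fin n => D)).prod
    (Measure.measurePreserving_swap (μ := Measure.pi fun _ : Fin n => L) (ν := D))
  have h3 := (measurePreserving_prodAssoc (Measure.pi fun _ : Fin n => D) D
    (Measure.pi fun _ : Fin n => L)).symm
  have h4 := (measurePreserving_update D i).prod
    (MeasurePreserving.id (Measure.pi fun _ : Fin n => L))
  exact h4.comp (h3.comp (h2.comp h1))

/-- One formula covers both scenarios: `y = β * x`, `H = G` for disadvantaged `i`, and `y = x`, `H =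
insert i G` after the move. The open set and the constant agree in both. -/
theorem lowWeight_eq_of_estimated [NeZero p] {k : Fin p → ℕ} {G G' H : Finset (Fin n)}
    {β lam : ℝ} {i : Fin n} {w : (Fin n → ℝ) × (Fin n → PrefList p)} {v : Fin n → ℝ} {y : ℝ}
    (hest : estimated G' β w.1 = Function.update v i y)
    (hinj : Function.Injective (Function.update v i y)) (hH : H.erase i = G) :
    lowWeight k G' H β lam i w =
      {y | y ∈ openValues k w.2 v i (w.2 i 0) ∧ y ≤ lam}.indicator (fun _ =>
        (1 + ((G.filter fun j => j ∈ firstChoice w.2 (runList w.2 (othersList v i)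
          (fun _ => none, Function.update k (w.2 i 0) (k (w.2 i 0) - 1))).1 ∧
            v j ≤ lam).card : ℝ))⁻¹) y := by
  have hi : i ∈ lowChoice k G' β lam w ↔ y ∈ openValues k w.2 v i (w.2 i 0) ∧ y ≤ lam := by
    rw [lowChoice, Finset.mem_filter, hest, mem_firstChoice_update_self hinj,
      Function.update_self]
  have hi' : i ∈ lowChoice k G' β lam w ↔
      y ∈ {y | y ∈ openValues k w.2 v i (w.2 i 0) ∧ y ≤ lam} := hi
  unfold lowWeight
  by_cases h : i ∈ lowChoice k G' β lam w
  · rw [if_pos h, Set.indicator_of_mem (hi'.1 h)]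
    rw [hi] at h
    congr 4
    rw [← Finset.inter_erase, hH]
    ext j
    simp only [Finset.mem_inter, Finset.mem_filter, lowChoice, hest]
    by_cases hj : j ∈ G
    · have hji : j ≠ i := by
        rw [← hH] at hj
        exact Finset.ne_of_mem_erase hj
      rw [mem_firstChoice_update_of_ne hinj h.1 hji, Function.update_of_ne hji]
      tauto
    · simp [hj]
  · rw [if_neg h, Set.indicator_of_notMem fun h' => h (hi'.2 h')]

/-- At least `K` candidates other than `i` have an estimated utility above `t`. -/
def manyAbove (G : Finset (Fin n)) (β t : ℝ) (K : ℕ) (i : Fin n) : Set (Fin n → ℝ) :=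
  {u | K ≤ (Finset.univ.filter fun j => j ≠ i ∧ t < estimated G β u j).card}

theorem measurable_card_estimated (G : Finset (Fin n)) (β t : ℝ) (q : Fin n → Prop)
    [DecidablePred q] : Measurable fun u : Fin n → ℝ =>
      (Finset.univ.filter fun j => q j ∧ t < estimated G β u j).card := by
  simp only [Finset.card_filter]
  refine Finset.measurable_sum _ fun j _ => ?_
  have h : MeasurableSet {u : Fin n → ℝ | t < estimated G β u j} :=
    measurableSet_lt measurable_const ((measurable_pi_apply j).comp (measurable_estimated G β))
  by_cases hq : q j
  · simp only [hq, true_and]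
    exact Measurable.ite h measurable_const measurable_const
  · simp [hq]

theorem measurableSet_manyAbove (G : Finset (Fin n)) (β t : ℝ) (K : ℕ) (i : Fin n) :
    MeasurableSet (manyAbove G β t K i) :=
  measurableSet_le measurable_const (measurable_card_estimated G β t _)

theorem update_mem_manyAbove {G : Finset (Fin n)} {β t : ℝ} {K : ℕ} {i : Fin n}
    {u : Fin n → ℝ} {x : ℝ} :
    Function.update u i x ∈ manyAbove G β t K i ↔ u ∈ manyAbove G β t K i := by
  have h : (Finset.univ.filter fun j => j ≠ i ∧ t < estimated G β (Function.update u i x) j) =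
      (Finset.univ.filter fun j => j ≠ i ∧ t < estimated G β u j) := by
    refine Finset.filter_congr fun j _ => and_congr_right fun hj => ?_
    simp [estimated, hj]
  unfold manyAbove
  rw [Set.mem_ofPred_eq, h, Set.mem_ofPred_eq]

/-- The weight of `i`, restricted to instances with many competitors above `t`. -/
def goodWeight [NeZero p] (k : Fin p → ℕ) (G : Finset (Fin n)) (β lam t : ℝ) (i : Fin n)
    (w : (Fin n → ℝ) × (Fin n → PrefList p)) : ℝ :=
  (manyAbove G β t (∑ l, k l) i).indicator (fun _ => lowWeight k G G β lam i w) w.1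

theorem measurable_goodWeight [NeZero p] (k : Fin p → ℕ) (G : Finset (Fin n)) (β lam t : ℝ)
    (i : Fin n) : Measurable (goodWeight k G β lam t i) := by
  unfold goodWeight
  simp only [Set.indicator]
  exact Measurable.ite (measurable_fst (measurableSet_manyAbove G β t _ i))
    (measurable_lowWeight k G G β lam i) measurable_const

theorem goodWeight_mem_Icc [NeZero p] (k : Fin p → ℕ) (G : Finset (Fin n)) (β lam t : ℝ)
    (i : Fin n) (w : (Fin n → ℝ) × (Fin n → PrefList p)) :
    goodWeight k G β lam t i w ∈ Set.Icc (0 : ℝ) 1 := by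
  unfold goodWeight Set.indicator
  split
  · exact lowWeight_mem_Icc _ _ _ _ _ _ _
  · simp

theorem integrable_goodWeight [NeZero p] (D : Measure ℝ) (L : Measure (PrefList p))
    [IsProbabilityMeasure D] [IsProbabilityMeasure L] (k : Fin p → ℕ) (G : Finset (Fin n))
    (β lam t : ℝ) (i : Fin n) : Integrable (goodWeight k G β lam t i) (instanceLaw D L n) :=
  Integrable.of_mem_Icc 0 1 (measurable_goodWeight k G β lam t i).aemeasurable
    (ae_of_all _ fun w => goodWeight_mem_Icc k G β lam t i w)

/-- Moving a candidate from the disadvantaged to the advantaged group. -/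
theorem integral_goodWeight_le [NeZero p] {D : Measure ℝ} (hD : HasLogConcaveDensity D)
    [IsProbabilityMeasure D] (L : Measure (PrefList p)) [IsProbabilityMeasure L] (k : Fin p → ℕ)
    {G : Finset (Fin n)} {i : Fin n} (hi : i ∉ G) {t lam β e : ℝ} (ht : 0 ≤ t) (hβ : 0 < β)
    (hβ2 : β ≤ 1 / 2) (he : 0 ≤ e) (hte : tail D t + tail D (t / β) ≤ 1 + e) :
    ∫ w, goodWeight k G β lam t i w ∂(instanceLaw D L n) ≤
      (2 * β * Real.log (1 / β) + 2 * e) * (1 + 8 * tail D lam) *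
        ∫ w, lowWeight k (insert i G) (insert i G) β lam i w ∂(instanceLaw D L n) +
      4 * tail D lam ^ 2 := by
  have := nullSingletonClass_of_hasLogConcaveDensity hD
  have hΘ := measurePreserving_instanceLaw_update D L i
  -- Fubini after resampling the utility of `i`; the comparison can then be made with everything
  -- else fixed.
  have key : ∀ f : (Fin n → ℝ) × (Fin n → PrefList p) → ℝ, Integrable f (instanceLaw D L n) →
      ∫ w, f w ∂(instanceLaw D L n) =
        ∫ w, (∫ x, f (Function.update w.1 i x, w.2) ∂D) ∂(instanceLaw D L n) ∧
      Integrable (fun w : (Fin n → ℝ) × (Fin n → PrefList p) =>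
        ∫ x, f (Function.update w.1 i x, w.2) ∂D) (instanceLaw D L n) := by
    intro f hf
    have h1 := integral_map (μ := (instanceLaw D L n).prod D) hΘ.measurable.aemeasurable (f := f)
      (by rw [hΘ.map_eq]; exact hf.1)
    rw [hΘ.map_eq] at h1
    have h2 := hΘ.integrable_comp_of_integrable hf
    exact ⟨h1.trans (integral_prod _ h2), h2.integral_prod_left⟩
  obtain ⟨hA, hAi⟩ := key _ (integrable_goodWeight D L k G β lam t i)
  obtain ⟨hB, hBi⟩ := key _ (integrable_lowWeight D L k (insert i G) (insert i G) β lam i)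
  rw [hA, hB, ← integral_const_mul]
  have hconst : (4 * tail D lam ^ 2) = ∫ w, (4 * tail D lam ^ 2) ∂(instanceLaw D L n) := by simp
  rw [hconst, ← integral_add (hBi.const_mul _) (integrable_const _)]
  refine integral_mono_ae hAi ((hBi.const_mul _).add (integrable_const _)) ?_
  have hinj1 := Measure.ae_ae_of_ae_prod (hΘ.quasiMeasurePreserving.ae
    (ae_instanceLaw_of_ae D L (ae_injective_estimated D G hβ.ne')))
  have hinj2 := Measure.ae_ae_of_ae_prod (hΘ.quasiMeasurePreserving.ae
    (ae_instanceLaw_of_ae D L (ae_injective_estimated D (insert i G) hβ.ne')))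
  filter_upwards [hinj1, hinj2] with w hw1 hw2
  set v := estimated G β w.1 with hv
  set U := openValues k w.2 v i (w.2 i 0) with hU
  set c := (1 + ((G.filter fun j => j ∈ firstChoice w.2 (runList w.2 (othersList v i)
          (fun _ => none, Function.update k (w.2 i 0) (k (w.2 i 0) - 1))).1 ∧
            v j ≤ lam).card : ℝ))⁻¹ with hc
  have hc0 : 0 ≤ c := by positivity
  have hc1 : c ≤ 1 := by
    refine inv_le_one_of_one_le₀ ?_
    have : (0 : ℝ) ≤ ((G.filter fun j => j ∈ firstChoice w.2 (runList w.2 (othersList v i)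
          (fun _ => none, Function.update k (w.2 i 0) (k (w.2 i 0) - 1))).1 ∧
            v j ≤ lam).card : ℝ) := by positivity
    linarith
  have hUm : MeasurableSet U :=
    (show IsUpperSet U from fun x y hxy hx => openValues_of_le hx hxy).ordConnected.measurableSet
  have hBm : MeasurableSet {x | x ∈ U ∧ x ≤ lam} := hUm.inter measurableSet_Iic
  have hAm : MeasurableSet {x | β * x ∈ U ∧ β * x ≤ lam} :=
    (measurable_const_mul β) hBm
  have hΨ : ∫ x, lowWeight k (insert i G) (insert i G) β lam i (Function.update w.1 i x, w.2) ∂D =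
      D.real {x | x ∈ U ∧ x ≤ lam} * c := by
    rw [← smul_eq_mul, ← integral_indicator_const _ hBm]
    refine integral_congr_ae ?_
    filter_upwards [hw2] with x hx
    rw [estimated_insert_update] at hx
    rw [lowWeight_eq_of_estimated (estimated_insert_update β w.1 x) hx
      (Finset.erase_insert hi)]
  have hrhs : 0 ≤ (2 * β * Real.log (1 / β) + 2 * e) * (1 + 8 * tail D lam) *
      (D.real {x | x ∈ U ∧ x ≤ lam} * c) + 4 * tail D lam ^ 2 := by
    have h1 : 0 ≤ tail D lam := tail_nonneg D lam
    have h2 : 0 ≤ 2 * β * Real.log (1 / β) := mul_nonneg (by linarith)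
      (Real.log_nonneg (by rw [le_div_iff₀ hβ]; linarith))
    have h3 : 0 ≤ D.real {x | x ∈ U ∧ x ≤ lam} := measureReal_nonneg
    positivity
  rw [hΨ]
  -- This event ignores the utility of `i`, so it is constant during the resampling; off it the
  -- left-hand side vanishes.
  by_cases hgood : w.1 ∈ manyAbove G β t (∑ l, k l) i
  · have hΦ : ∫ x, goodWeight k G β lam t i (Function.update w.1 i x, w.2) ∂D =
        D.real {x | β * x ∈ U ∧ β * x ≤ lam} * c := by
      rw [← smul_eq_mul, ← integral_indicator_const _ hAm]
      refine integral_congr_ae ?_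
      filter_upwards [hw1] with x hx
      rw [estimated_update_of_notMem hi] at hx
      rw [goodWeight, Set.indicator_of_mem (update_mem_manyAbove.2 hgood),
        lowWeight_eq_of_estimated (estimated_update_of_notMem hi β w.1 x) hx
          (Finset.erase_eq_of_notMem hi)]
      rfl
    rw [hΦ]
    have h := measureReal_openSet_le (lam := lam) hD (U := U) (fun x hx y hxy => openValues_of_le hx hxy) ht
      (fun x hx => lt_of_mem_openValues hgood hx) hβ hβ2 he hte
    have h2 := mul_le_mul_of_nonneg_right h hc0
    have h3 : 4 * tail D lam ^ 2 * c ≤ 4 * tail D lam ^ 2 :=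
      mul_le_of_le_one_right (by positivity) hc1
    linarith
  · have hΦ : ∫ x, goodWeight k G β lam t i (Function.update w.1 i x, w.2) ∂D = 0 := by
      rw [← integral_zero ℝ ℝ (μ := D)]
      congr 1
      ext x
      rw [goodWeight, Set.indicator_of_notMem (fun h => hgood (update_mem_manyAbove.1 h))]
    rw [hΦ]
    exact hrhs

end

/-! ### The bound for preference-based fairness. -/

noncomputable section

variable {n p : ℕ}

theorem fairnessRatio_nonneg (G S : Finset (Fin n)) : 0 ≤ fairnessRatio G S := by
  unfold fairnessRatio groupFraction
  positivity

theorem fairnessRatio_le_one (G S : Finset (Fin n)) : fairnessRatio G S ≤ 1 :=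
  div_le_one_of_le₀ min_le_max (by unfold groupFraction; positivity)

theorem fairnessRatio_le_div {G S : Finset (Fin n)} {K : ℕ} (hK : 1 ≤ K) (hG : G.card = K)
    (hG' : Gᶜ.card = K) (h : 0 < (S ∩ G).card) :
    fairnessRatio G S ≤ ((S ∩ Gᶜ).card : ℝ) / ((S ∩ G).card : ℝ) := by
  unfold fairnessRatio groupFraction
  rw [hG, hG']
  have hK' : (0 : ℝ) < K := by exact_mod_cast hK
  have h' : (0 : ℝ) < ((S ∩ G).card : ℝ) := by exact_mod_cast h
  calc _ ≤ (((S ∩ Gᶜ).card : ℝ) / K) / (((S ∩ G).card : ℝ) / K) :=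
        div_le_div₀ (by positivity) (min_le_right _ _) (by positivity) (le_max_left _ _)
    _ = _ := by field_simp

theorem card_add_self {G : Finset (Fin n)} {K : ℕ} (hG : G.card = K) (hG' : Gᶜ.card = K) :
    n = K + K := by
  have := Finset.card_add_card_compl G
  rw [hG, hG', Fintype.card_fin] at this
  exact this.symm

variable [NeZero p]

/-- Outside the exceptional events, the weights control the ratio. -/
theorem fairnessRatio_le_sum {k : Fin p → ℕ} (hk : ∀ l, 1 ≤ k l) {G : Finset (Fin n)} {K : ℕ}
    (hK : 1 ≤ K) (hkK : ∑ l, k l = K) (hG : G.card = K) (hG' : Gᶜ.card = K) {β lam t : ℝ}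
    {w : (Fin n → ℝ) × (Fin n → PrefList p)} (hinj : Function.Injective (estimated G β w.1))
    (h1 : ∃ j ∈ G, lam < w.1 j) (h2 : ∀ j ∈ Gᶜ, β * w.1 j ≤ lam)
    (h3 : K < (Finset.univ.filter fun j => t < estimated G β w.1 j).card) :
    fairnessRatio G (firstChoice w.2 (stableAlgorithm k (estimated G β w.1) w.2)) ≤
      ∑ i ∈ Gᶜ, goodWeight k G β lam t i w := by
  set v := estimated G β w.1 with hv
  set R := firstChoice w.2 (stableAlgorithm k v w.2) with hR
  set A := lowChoice k G β lam w with hA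
  have hAR : A = R.filter fun j => v j ≤ lam := rfl
  have hgood : ∀ i ∈ Gᶜ, goodWeight k G β lam t i w =
      if i ∈ A then (1 + ((A ∩ G).card : ℝ))⁻¹ else 0 := by
    intro i hi
    rw [goodWeight, Set.indicator_of_mem, lowWeight, ← hA, Finset.erase_eq_of_notMem]
    · exact fun h => Finset.mem_compl.1 hi (Finset.mem_inter.1 h).2
    · show ∑ l, k l ≤ (Finset.univ.filter fun j => j ≠ i ∧ t < v j).card
      rw [hkK]
      have h4 : (Finset.univ.filter fun j => t < v j) ⊆
          insert i (Finset.univ.filter fun j => j ≠ i ∧ t < v j) := by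
        intro j hj
        by_cases hji : j = i
        · simp [hji]
        · simpa [hji] using hj
      have := (Finset.card_le_card h4).trans (Finset.card_insert_le _ _)
      omega
  rw [Finset.sum_congr rfl hgood, Finset.sum_ite_mem, Finset.sum_const, nsmul_eq_mul]
  obtain ⟨j, hj, hjlam⟩ := h1
  -- The best candidate lies above `lam`, hence in `G`; being processed first it obtains its first
  -- choice, but it is not counted in `A`. This supplies the `1` in the denominator of the weights.
  obtain ⟨a, -, ha⟩ := Finset.exists_max_image Finset.univ v ⟨j, Finset.mem_univ _⟩
  have hlow : ∀ b ∈ Gᶜ, v b ≤ lam := by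
    intro b hb
    have := h2 b hb
    simpa [hv, estimated, Finset.mem_compl.1 hb] using this
  have hvj : v j = w.1 j := by simp [hv, estimated, hj]
  have halam : lam < v a := by
    have := ha j (Finset.mem_univ _)
    linarith
  have haG : a ∈ G := by
    by_contra h
    exact absurd (hlow a (Finset.mem_compl.2 h)) (not_le.2 halam)
  have haR : a ∈ R := by
    refine mem_firstChoice_of_forall_lt hk fun b hb => ?_
    exact lt_of_le_of_ne (ha b (Finset.mem_univ _)) fun h => hb (hinj h)
  have hcard : (A ∩ G).card + 1 ≤ (R ∩ G).card := by
    have haA : a ∉ A ∩ G := by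
      rw [hAR]
      simp [halam]
    rw [← Finset.card_insert_of_notMem haA]
    refine Finset.card_le_card (Finset.insert_subset (Finset.mem_inter.2 ⟨haR, haG⟩) ?_)
    exact Finset.inter_subset_inter_right (by rw [hAR]; exact Finset.filter_subset _ _)
  have hcompl : R ∩ Gᶜ = Gᶜ ∩ A := by
    ext b
    rw [hAR]
    simp only [Finset.mem_inter, Finset.mem_filter]
    constructor
    · exact fun h => ⟨h.2, h.1, hlow b h.2⟩
    · exact fun h => ⟨h.2.1, h.1⟩
  refine (fairnessRatio_le_div hK hG hG' (by omega)).trans ?_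
  rw [hcompl, div_eq_mul_inv]
  refine mul_le_mul_of_nonneg_left (inv_anti₀ (by positivity) ?_) (by positivity)
  have : (((A ∩ G).card : ℝ) + 1) ≤ ((R ∩ G).card : ℝ) := by exact_mod_cast hcard
  linarith

theorem measurable_fairnessRatio_firstChoice (k : Fin p → ℕ) (G : Finset (Fin n)) (β : ℝ) :
    Measurable fun w : (Fin n → ℝ) × (Fin n → PrefList p) =>
      fairnessRatio G (firstChoice w.2 (stableAlgorithm k (estimated G β w.1) w.2)) :=
  measurable_stable_comp k G β fun s M => fairnessRatio G (firstChoice s M)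

theorem integrable_fairnessRatio_firstChoice (D : Measure ℝ) (L : Measure (PrefList p))
    [IsProbabilityMeasure D] [IsProbabilityMeasure L] (k : Fin p → ℕ) (G : Finset (Fin n))
    (β : ℝ) : Integrable (fun w : (Fin n → ℝ) × (Fin n → PrefList p) =>
      fairnessRatio G (firstChoice w.2 (stableAlgorithm k (estimated G β w.1) w.2)))
      (instanceLaw D L n) :=
  Integrable.of_mem_Icc 0 1 (measurable_fairnessRatio_firstChoice k G β).aemeasurable
    (ae_of_all _ fun _ => ⟨fairnessRatio_nonneg _ _, fairnessRatio_le_one _ _⟩)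

theorem preferenceFairness_le_one (D : Measure ℝ) (L : Measure (PrefList p))
    [IsProbabilityMeasure D] [IsProbabilityMeasure L] (k : Fin p → ℕ) (G : Finset (Fin n))
    (β : ℝ) : preferenceFairness D L G β (stableAlgorithm k) ≤ 1 := by
  calc preferenceFairness D L G β (stableAlgorithm k) ≤ ∫ w, (1 : ℝ) ∂(instanceLaw D L n) :=
        integral_mono (integrable_fairnessRatio_firstChoice D L k G β) (integrable_const _)
          fun w => fairnessRatio_le_one _ _
    _ = 1 := by simp

/-- The level `lam` has tail `d`. The error terms are the probabilities that no advantaged candidate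
exceeds `lam`, that some disadvantaged one does, or that at most `K` candidates exceed `t`. The
factor `5` combines the second of these with the truncation loss `4 * d ^ 2` of each of the `K`
comparisons. -/
theorem preferenceFairness_le_of_levels {D : Measure ℝ} (hD : HasLogConcaveDensity D)
    [IsProbabilityMeasure D] (L : Measure (PrefList p)) [IsProbabilityMeasure L]
    {k : Fin p → ℕ} (hk : ∀ l, 1 ≤ k l) {G : Finset (Fin n)} {K : ℕ}
    (hK : 1 ≤ K) (hkK : ∑ l, k l = K) (hG : G.card = K) (hG' : Gᶜ.card = K) {β d e : ℝ}
    (hβ : 0 < β) (hβ2 : β ≤ 1 / 2) (hd : 0 ≤ d) (hd8 : d ≤ 1 / 8) (he : 0 ≤ e) (he1 : e ≤ 1) :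
    preferenceFairness D L G β (stableAlgorithm k) ≤
      (2 * β * Real.log (1 / β) + 2 * e) * (1 + 8 * d) +
        ((1 - d) ^ K + 5 * K * d ^ 2 + Real.exp (-(K * e ^ 2))) := by
  have := nullSingletonClass_of_hasLogConcaveDensity hD
  obtain ⟨lam, hlam0, hlam⟩ := exists_tail_eq hD hd (by linarith)
  obtain ⟨t, ht0, ht⟩ := exists_tail_add_tail_eq hD (d := 1 + e) hβ (by linarith) (by linarith)
    (by linarith)
  set B₁ : Set (Fin n → ℝ) := {u | ∀ j ∈ G, u j ≤ lam} with hB₁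
  set B₂ : Set (Fin n → ℝ) := {u | ∃ j ∈ Gᶜ, lam < β * u j} with hB₂
  set B₃ : Set (Fin n → ℝ) :=
    {u | (Finset.univ.filter fun j => t < estimated G β u j).card ≤ K} with hB₃
  have hm₁ : MeasurableSet B₁ := by
    have : B₁ = ⋂ j ∈ G, {u | u j ≤ lam} := by ext; simp [hB₁]
    rw [this]
    exact Finset.measurableSet_biInter _ fun j _ =>
      measurableSet_le (measurable_pi_apply j) measurable_const
  have hm₂ : MeasurableSet B₂ := by
    have : B₂ = ⋃ j ∈ Gᶜ, {u | lam < β * u j} := by ext; simp [hB₂]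
    rw [this]
    exact Finset.measurableSet_biUnion _ fun j _ =>
      measurableSet_lt measurable_const (by fun_prop)
  have hm₃ : MeasurableSet B₃ := by
    have := measurable_card_estimated G β t fun _ => True
    simp only [true_and] at this
    exact measurableSet_le this measurable_const
  have hind : ∀ B : Set (Fin n → ℝ), MeasurableSet B →
      Integrable (fun w : (Fin n → ℝ) × (Fin n → PrefList p) =>
        B.indicator (fun _ => (1 : ℝ)) w.1) (instanceLaw D L n) ∧
      ∫ w, B.indicator (fun _ => (1 : ℝ)) w.1 ∂(instanceLaw D L n) =
        (Measure.pi fun _ : Fin n => D).real B := by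
    intro B hB
    have hmp : MeasurePreserving (Prod.fst : (Fin n → ℝ) × (Fin n → PrefList p) → (Fin n → ℝ))
        (instanceLaw D L n) (Measure.pi fun _ : Fin n => D) := measurePreserving_fst
    have hi : Integrable (B.indicator fun _ => (1 : ℝ)) (Measure.pi fun _ : Fin n => D) :=
      (integrable_const _).indicator hB
    refine ⟨hmp.integrable_comp_of_integrable hi, ?_⟩
    rw [← integral_indicator_one hB]
    have := integral_map (μ := instanceLaw D L n) hmp.measurable.aemeasurable
      (f := B.indicator fun _ => (1 : ℝ)) (by rw [hmp.map_eq]; exact hi.1)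
    rw [hmp.map_eq] at this
    exact this.symm
  have hsumint : Integrable (fun w => ∑ i ∈ Gᶜ, goodWeight k G β lam t i w)
      (instanceLaw D L n) :=
    integrable_finsetSum _ fun i _ => integrable_goodWeight D L k G β lam t i
  have hpt : ∀ᵐ w ∂(instanceLaw D L n),
      fairnessRatio G (firstChoice w.2 (stableAlgorithm k (estimated G β w.1) w.2)) ≤
        ((B₁.indicator (fun _ => (1 : ℝ)) w.1 + B₂.indicator (fun _ => (1 : ℝ)) w.1) +
          B₃.indicator (fun _ => (1 : ℝ)) w.1) + ∑ i ∈ Gᶜ, goodWeight k G β lam t i w := by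
    filter_upwards [ae_instanceLaw_of_ae D L (ae_injective_estimated D G hβ.ne')] with w hw
    have h0 : ∀ B : Set (Fin n → ℝ), 0 ≤ B.indicator (fun _ => (1 : ℝ)) w.1 := fun B =>
      Set.indicator_nonneg (fun _ _ => zero_le_one) _
    have hs0 : 0 ≤ ∑ i ∈ Gᶜ, goodWeight k G β lam t i w :=
      Finset.sum_nonneg fun i _ => (goodWeight_mem_Icc k G β lam t i w).1
    have hle1 := fairnessRatio_le_one G
      (firstChoice w.2 (stableAlgorithm k (estimated G β w.1) w.2))
    by_cases h1 : w.1 ∈ B₁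
    · have := Set.indicator_of_mem h1 fun _ => (1 : ℝ)
      linarith [h0 B₂, h0 B₃]
    by_cases h2 : w.1 ∈ B₂
    · have := Set.indicator_of_mem h2 fun _ => (1 : ℝ)
      linarith [h0 B₁, h0 B₃]
    by_cases h3 : w.1 ∈ B₃
    · have := Set.indicator_of_mem h3 fun _ => (1 : ℝ)
      linarith [h0 B₁, h0 B₂]
    have h := fairnessRatio_le_sum hk hK hkK hG hG' hw (lam := lam) (t := t)
      (by simpa [hB₁] using h1) (by simpa [hB₂] using h2) (by simpa [hB₃] using h3)
    linarith [h0 B₁, h0 B₂, h0 B₃]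
  have hmain : preferenceFairness D L G β (stableAlgorithm k) ≤
      (((Measure.pi fun _ : Fin n => D).real B₁ + (Measure.pi fun _ : Fin n => D).real B₂) +
        (Measure.pi fun _ : Fin n => D).real B₃) +
        ∑ i ∈ Gᶜ, ∫ w, goodWeight k G β lam t i w ∂(instanceLaw D L n) := by
    refine (integral_mono_ae (integrable_fairnessRatio_firstChoice D L k G β)
      ((((hind B₁ hm₁).1.add (hind B₂ hm₂).1).add (hind B₃ hm₃).1).add hsumint) hpt).trans ?_
    rw [integral_add' (((hind B₁ hm₁).1.add (hind B₂ hm₂).1).add (hind B₃ hm₃).1) hsumint,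
      integral_add' ((hind B₁ hm₁).1.add (hind B₂ hm₂).1) (hind B₃ hm₃).1,
      integral_add' (hind B₁ hm₁).1 (hind B₂ hm₂).1, (hind B₁ hm₁).2, (hind B₂ hm₂).2,
      (hind B₃ hm₃).2, integral_finsetSum _ fun i _ => integrable_goodWeight D L k G β lam t i]
  have hP₁ : (Measure.pi fun _ : Fin n => D).real B₁ = (1 - d) ^ K := by
    rw [measureReal_forall_le, hlam, hG]
  -- Since `1 / β ≥ 2`, a disadvantaged candidate exceeds `lam` with probability at most `d ^ 2`.
  -- Hence `d` can be chosen with `K * d` large and `K * d ^ 2` small.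
  have hP₂ : (Measure.pi fun _ : Fin n => D).real B₂ ≤ K * d ^ 2 := by
    refine (measureReal_exists_gt D Gᶜ hβ lam).trans ?_
    rw [hG']
    refine mul_le_mul_of_nonneg_left ?_ (by positivity)
    refine (tail_div_le hD hlam0 hβ (by linarith)).trans ?_
    rw [hlam, ← Real.rpow_natCast]
    have h2 : (2 : ℝ) ≤ 1 / β := by rw [le_div_iff₀ hβ]; linarith
    rcases hd.eq_or_lt with rfl | hd
    · rw [Real.zero_rpow (by linarith), Real.zero_rpow (by norm_num)]
    · exact Real.rpow_le_rpow_of_exponent_ge hd (by linarith) (by exact_mod_cast h2)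
  have hP₃ : (Measure.pi fun _ : Fin n => D).real B₃ ≤ Real.exp (-(K * e ^ 2)) :=
    measureReal_card_le D G hG hG' hβ he ht
  have hr0 : 0 ≤ 2 * β * Real.log (1 / β) := mul_nonneg (by linarith)
    (Real.log_nonneg (by rw [le_div_iff₀ hβ]; linarith))
  have hK0 : (0 : ℝ) < K := by exact_mod_cast hK
  have hW : ∀ i ∈ Gᶜ, ∫ w, goodWeight k G β lam t i w ∂(instanceLaw D L n) ≤
      (2 * β * Real.log (1 / β) + 2 * e) * (1 + 8 * d) * (K : ℝ)⁻¹ + 4 * d ^ 2 := by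
    intro i hi
    have hiG := Finset.mem_compl.1 hi
    have h1 := integral_goodWeight_le (lam := lam) hD L k hiG ht0 hβ hβ2 he ht.le
    rw [hlam] at h1
    refine h1.trans ?_
    -- The enlarged group has `K + 1` members; the resulting bound is weakened to `1 / K`.
    have h2 := integral_lowWeight_le D L k (G := insert i G) hβ.ne' lam (Finset.mem_insert_self _ _)
    rw [Finset.card_insert_of_notMem hiG, hG] at h2
    push_cast at h2
    have h3 : 0 ≤ ∫ w, lowWeight k (insert i G) (insert i G) β lam i w ∂(instanceLaw D L n) :=
      integral_nonneg fun w => (lowWeight_mem_Icc k _ _ β lam i w).1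
    have h4 : ∫ w, lowWeight k (insert i G) (insert i G) β lam i w ∂(instanceLaw D L n) ≤
        (K : ℝ)⁻¹ := by
      rw [← one_div, le_div_iff₀ hK0]
      linarith
    have := mul_le_mul_of_nonneg_left h4
      (show 0 ≤ (2 * β * Real.log (1 / β) + 2 * e) * (1 + 8 * d) by positivity)
    linarith
  have hsum := Finset.sum_le_sum hW
  rw [Finset.sum_const, hG', nsmul_eq_mul] at hsum
  have : (K : ℝ) * ((2 * β * Real.log (1 / β) + 2 * e) * (1 + 8 * d) * (K : ℝ)⁻¹ + 4 * d ^ 2) =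
      (2 * β * Real.log (1 / β) + 2 * e) * (1 + 8 * d) + 4 * K * d ^ 2 := by
    field_simp
  rw [this] at hsum
  rw [hP₁] at hmain
  linarith

/-- The choices are `d = K ^ (-3/4)` and `e = √(log n / n)`: then `K * d ^ 2 = K ^ (-1/2)`, `(1 - d)
^ K ≤ exp (-K ^ (1/4))` and `exp (-(K * e ^ 2)) = n ^ (-1/2)`. -/
theorem preferenceFairness_le {D : Measure ℝ} (hD : HasLogConcaveDensity D)
    [IsProbabilityMeasure D] (L : Measure (PrefList p)) [IsProbabilityMeasure L]
    {k : Fin p → ℕ} (hk : ∀ l, 1 ≤ k l) {G : Finset (Fin n)} {K : ℕ}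
    (hK : 1 ≤ K) (hkK : ∑ l, k l = K) (hG : G.card = K) (hG' : Gᶜ.card = K) {β : ℝ}
    (hβ : 0 < β) (hβ2 : β ≤ 1 / 2) :
    preferenceFairness D L G β (stableAlgorithm k) ≤
      2 * β * Real.log (1 / β) + 100 * (√(Real.log n) / √n) := by
  have hn := card_add_self hG hG'
  have hK0 : (1 : ℝ) ≤ K := by exact_mod_cast hK
  have hnK : (n : ℝ) = 2 * K := by rw [hn]; push_cast; ring
  have hn2 : (2 : ℝ) ≤ n := by linarith
  set e := √(Real.log n) / √n with he
  have he0 : 0 ≤ e := by positivity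
  have hlog : 0.69 ≤ Real.log n := log_two_le hn2
  have he2 : e ^ 2 = Real.log n / n := by
    rw [he, div_pow, Real.sq_sqrt (by linarith), Real.sq_sqrt (by linarith)]
  have he1 : e ≤ 1 := by
    have : e ^ 2 ≤ 1 := by
      rw [he2, div_le_one (by linarith)]
      have := Real.log_le_self (show (0 : ℝ) ≤ n by linarith)
      exact this
    nlinarith
  -- A fourth root of `K` turns every error term into a power of `x` or `exp (-x)`.
  set x := √√(K : ℝ) with hx
  have hx2 : x ^ 2 = √(K : ℝ) := Real.sq_sqrt (Real.sqrt_nonneg _)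
  have hx4 : x ^ 4 = K := by
    rw [show x ^ 4 = (x ^ 2) ^ 2 by ring, hx2, Real.sq_sqrt (by linarith)]
  have hx0 : 0 < x := by rw [hx]; positivity
  have hxe : (x ^ 2)⁻¹ ≤ 2 * e := by
    rw [inv_le_iff_one_le_mul₀ (by positivity)]
    have h1 : 1 ≤ (2 * e * x ^ 2) ^ 2 := by
      rw [mul_pow, mul_pow, he2, ← pow_mul, show 2 * 2 = 4 from rfl, hx4, hnK]
      have : Real.log (2 * K) = Real.log n := by rw [hnK]
      rw [this]
      field_simp
      linarith
    by_contra! h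
    have h0 : 0 ≤ 2 * e * x ^ 2 := by positivity
    nlinarith
  have hr0 : 0 ≤ 2 * β * Real.log (1 / β) := mul_nonneg (by linarith)
    (Real.log_nonneg (by rw [le_div_iff₀ hβ]; linarith))
  -- For `K < 16` the error term exceeds `1` and the bound is trivial.
  rcases lt_or_ge x 2 with hx2' | hx2'
  · have h1 : (1 : ℝ) / 4 ≤ (x ^ 2)⁻¹ := by
      rw [one_div]
      exact inv_anti₀ (by positivity) (by nlinarith)
    have := preferenceFairness_le_one D L k G β
    linarith
  · set d := (x ^ 3)⁻¹ with hd
    have hd0 : 0 ≤ d := by positivity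
    have hx8 : (8 : ℝ) ≤ x ^ 3 := by
      calc (8 : ℝ) = 2 ^ 3 := by norm_num
        _ ≤ x ^ 3 := pow_le_pow_left₀ (by norm_num) hx2' 3
    have hd8 : d ≤ 1 / 8 := by
      rw [hd, one_div]
      exact inv_anti₀ (by norm_num) hx8
    have hdx : d ≤ (x ^ 2)⁻¹ := inv_anti₀ (by positivity) (pow_le_pow_right₀ (by linarith) (by norm_num))
    have h := preferenceFairness_le_of_levels hD L hk hK hkK hG hG' hβ hβ2 hd0 hd8 he0 he1
    have hb1 : (1 - d) ^ K ≤ 2 * (x ^ 2)⁻¹ := by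
      have h1 : (1 - d) ^ K ≤ Real.exp (-d) ^ K :=
        pow_le_pow_left₀ (by linarith) (by linarith [Real.add_one_le_exp (-d)]) K
      have h2 : Real.exp (-d) ^ K = Real.exp (-x) := by
        rw [← Real.exp_nat_mul, ← hx4, hd]
        congr 1
        field_simp
      have h3 := Real.quadratic_le_exp_of_nonneg hx0.le
      rw [h2] at h1
      refine h1.trans ?_
      rw [Real.exp_neg, ← div_eq_mul_inv, inv_le_comm₀ (Real.exp_pos _) (by positivity), inv_div]
      nlinarith
    have hb2 : 5 * K * d ^ 2 = 5 * (x ^ 2)⁻¹ := by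
      rw [← hx4, hd]
      field_simp
    have hb3 : Real.exp (-(K * e ^ 2)) ≤ (x ^ 2)⁻¹ := by
      have h1 : K * e ^ 2 = Real.log n / 2 := by
        rw [he2, hnK]
        field_simp
      have h2 : Real.log (x ^ 2) ≤ Real.log n / 2 := by
        rw [hx2, Real.log_sqrt (by linarith)]
        have := Real.log_le_log (by linarith) (show (K : ℝ) ≤ n by linarith)
        linarith
      have h3 : x ^ 2 = Real.exp (Real.log (x ^ 2)) := (Real.exp_log (by positivity)).symm
      rw [h1, h3, ← Real.exp_neg, Real.exp_le_exp]
      linarith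
    have hr1 : 2 * β * Real.log (1 / β) ≤ 1 := by
      have := two_mul_log_div_le_one (s := 1 / β) (by rw [le_div_iff₀ hβ]; linarith)
      calc 2 * β * Real.log (1 / β) = 2 * Real.log (1 / β) / (1 / β) := by field_simp
        _ ≤ 1 := this
    have hprod : (2 * β * Real.log (1 / β) + 2 * e) * (1 + 8 * d) ≤
        2 * β * Real.log (1 / β) + 2 * e + 24 * d := by
      nlinarith
    linarith

end

/-! ### Utility-maximizing algorithms and representational fairness. -/

noncomputable section

variable {n p : ℕ}

theorem card_selected_le {k : Fin p → ℕ} {M : Selection n p} (h : Feasible k M) :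
    (selected M).card ≤ ∑ l, k l := by
  have h1 : selected M ⊆ Finset.univ.biUnion fun l => Finset.univ.filter fun i => M i = some l := by
    intro i hi
    obtain ⟨l, hl⟩ := Option.ne_none_iff_exists'.1 (Finset.mem_filter.1 hi).2
    simp [hl]
  exact (Finset.card_le_card h1).trans (Finset.card_biUnion_le.trans
    (Finset.sum_le_sum fun l _ => h l))

theorem selected_eq_topSet {k : Fin p → ℕ} {A : SelectionAlgorithm n p}
    (hA : IsUtilityMaximizing k A) {v : Fin n → ℝ} (s : Fin n → PrefList p) (hv : ∀ i, 0 < v i)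
    (hinj : Function.Injective v) (hn : ∑ l, k l ≤ n) :
    selected (A v s) = topSet (∑ l, k l) v := by
  obtain ⟨hf, hmax⟩ := hA v s fun i => (hv i).le
  refine eq_topSet_of_topSum_le hn (card_selected_le hf) hv hinj ?_
  have := hmax _ (feasible_stableAlgorithm k v s)
  rwa [utility, utility, selected_stableAlgorithm, ← topSum_eq] at this

theorem firstChoice_eq_selected (s : Fin n → PrefList 1) (M : Selection n 1) :
    firstChoice s M = selected M := by
  ext i
  rw [mem_firstChoice_iff, selected, Finset.mem_filter, Option.ne_none_iff_exists']
  simp [Subsingleton.elim (s i 0) 0]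

theorem ae_pos_of_hasLogConcaveDensity {D : Measure ℝ} (hD : HasLogConcaveDensity D) :
    ∀ᵐ x ∂D, 0 < x := by
  have := nullSingletonClass_of_hasLogConcaveDensity hD
  have h2 : ∀ᵐ x ∂D, x ≠ 0 := by
    rw [ae_iff]
    simp
  filter_upwards [ae_mem_Icc_of_hasLogConcaveDensity hD, h2] with x hx hx0
  exact lt_of_le_of_ne hx.1 (Ne.symm hx0)

theorem estimated_pos {G : Finset (Fin n)} {β : ℝ} (hβ : 0 < β) {u : Fin n → ℝ}
    (hu : ∀ i, 0 < u i) (i : Fin n) : 0 < estimated G β u i := by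
  unfold estimated
  split
  · exact hu i
  · exact mul_pos hβ (hu i)

/-- Utility-maximizing algorithms select the same candidates, almost surely. -/
theorem representationalFairness_eq {D : Measure ℝ} (hD : HasLogConcaveDensity D)
    [IsProbabilityMeasure D] (L : Measure (PrefList p)) [IsProbabilityMeasure L] {k : Fin p → ℕ}
    {A : SelectionAlgorithm n p} (hA : IsUtilityMaximizing k A) (hn : ∑ l, k l ≤ n)
    (G : Finset (Fin n)) {β : ℝ} (hβ : 0 < β) :
    representationalFairness D L G β A =
      ∫ u, fairnessRatio G (topSet (∑ l, k l) (estimated G β u))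
        ∂(Measure.pi fun _ : Fin n => D) := by
  have := nullSingletonClass_of_hasLogConcaveDensity hD
  have h1 : representationalFairness D L G β A =
      ∫ w, fairnessRatio G (topSet (∑ l, k l) (estimated G β w.1)) ∂(instanceLaw D L n) := by
    -- No measurability of `A` is needed: almost surely the values are distinct and positive, so the
    -- selected set is the top set.
    refine integral_congr_ae ?_
    filter_upwards [ae_instanceLaw_of_ae D L (ae_injective_estimated D G hβ.ne'),
      ae_instanceLaw_of_ae D L (ae_pi_of_ae D (ae_pos_of_hasLogConcaveDensity hD))] with w hw1 hw2
    rw [selected_eq_topSet hA w.2 (estimated_pos hβ hw2) hw1 hn]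
  rw [h1, instanceLaw]
  have := integral_fun_fst (μ := Measure.pi fun _ : Fin n => D)
    (ν := Measure.pi fun _ : Fin n => L)
    fun u => fairnessRatio G (topSet (∑ l, k l) (estimated G β u))
  simpa using this

theorem isUtilityMaximizing_stableAlgorithm {k : Fin p → ℕ} (hn : ∑ l, k l ≤ n) :
    IsUtilityMaximizing (n := n) k (stableAlgorithm k) := by
  refine fun v s hv => ⟨feasible_stableAlgorithm k v s, fun M hM => ?_⟩
  have := sum_le_topSum_of_nonneg hn (card_selected_le hM) hv
  rwa [topSum_eq, ← selected_stableAlgorithm k v s] at this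

/-- The top set depends only on the total capacity, so the institutions may be merged into one of
capacity `K`, where selection and first choice coincide. -/
theorem representationalFairness_le {D : Measure ℝ} (hD : HasLogConcaveDensity D)
    [IsProbabilityMeasure D] (L : Measure (PrefList p)) [IsProbabilityMeasure L] {k : Fin p → ℕ}
    {A : SelectionAlgorithm n p} (hA : IsUtilityMaximizing k A) {G : Finset (Fin n)} {K : ℕ}
    (hK : 1 ≤ K) (hkK : ∑ l, k l = K) (hG : G.card = K) (hG' : Gᶜ.card = K) {β : ℝ}
    (hβ : 0 < β) (hβ2 : β ≤ 1 / 2) :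
    representationalFairness D L G β A ≤
      2 * β * Real.log (1 / β) + 100 * (√(Real.log n) / √n) := by
  have hn := card_add_self hG hG'
  have h1 := preferenceFairness_le (p := 1) hD (Measure.dirac 1) (k := fun _ => K)
    (fun _ => hK) hK (by simp) hG hG' hβ hβ2
  have h2 := representationalFairness_eq (p := 1) hD (Measure.dirac 1) (k := fun _ => K)
    (isUtilityMaximizing_stableAlgorithm (by simp; omega)) (by simp; omega) G hβ
  rw [representationalFairness_eq hD L hA (by omega) G hβ, hkK]
  simp only [Finset.univ_unique, Finset.sum_const, Finset.card_singleton, one_smul] at h2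
  rw [← h2]
  unfold preferenceFairness at h1
  simp only [firstChoice_eq_selected] at h1
  exact h1

end

/-! ### Variance bounds. -/

noncomputable section

variable {n : ℕ}

theorem continuous_of_abs_sub_le_sum {f : (Fin n → ℝ) → ℝ}
    (hf : ∀ v w, |f v - f w| ≤ ∑ i, |v i - w i|) : Continuous f := by
  rw [continuous_iff_continuousAt]
  intro v
  rw [ContinuousAt, tendsto_iff_dist_tendsto_zero]
  refine squeeze_zero (fun _ => dist_nonneg) (fun w => hf w v) ?_
  have : Continuous fun w : Fin n → ℝ => ∑ i, |w i - v i| := by fun_prop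
  simpa using this.tendsto v

theorem ae_abs_le_of_abs_sub_le_sum {D : Measure ℝ} [IsProbabilityMeasure D]
    (hD : ∀ᵐ x ∂D, x ∈ Set.Icc (0 : ℝ) 1) {f : (Fin n → ℝ) → ℝ}
    (hf : ∀ v w, |f v - f w| ≤ ∑ i, |v i - w i|) :
    ∀ᵐ u ∂(Measure.pi fun _ : Fin n => D), ‖f u‖ ≤ |f 0| + n := by
  filter_upwards [ae_pi_of_ae D hD] with u hu
  have h1 := hf u 0
  have h2 : ∑ i, |u i - (0 : Fin n → ℝ) i| ≤ ∑ _i : Fin n, (1 : ℝ) :=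
    Finset.sum_le_sum fun i _ => by
      rw [Pi.zero_apply, sub_zero, abs_of_nonneg (hu i).1]
      exact (hu i).2
  have h3 : |f u| ≤ |f 0| + |f u - f 0| := by
    have := abs_add_le (f 0) (f u - f 0)
    rwa [add_sub_cancel] at this
  simp only [Finset.sum_const, Finset.card_univ, Fintype.card_fin, nsmul_eq_mul, mul_one] at h2
  rw [Real.norm_eq_abs]
  linarith

theorem integral_sub_sq_eq {Ω : Type*} [MeasurableSpace Ω] {P : Measure Ω} [IsProbabilityMeasure P]
    {h : Ω → ℝ} (h1 : Integrable h P) (h2 : Integrable (fun x => (h x) ^ 2) P) (c : ℝ) :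
    ∫ x, (h x - c) ^ 2 ∂P = ∫ x, (h x - ∫ y, h y ∂P) ^ 2 ∂P + (∫ y, h y ∂P - c) ^ 2 := by
  have key : ∀ a : ℝ, ∫ x, (h x - a) ^ 2 ∂P =
      ∫ x, (h x) ^ 2 ∂P - 2 * a * ∫ x, h x ∂P + a ^ 2 := by
    intro a
    have : ∀ x, (h x - a) ^ 2 = (h x ^ 2 - 2 * a * h x) + a ^ 2 := fun x => by ring
    simp only [this]
    rw [integral_add (f := fun x => h x ^ 2 - 2 * a * h x) (h2.sub (h1.const_mul _))
      (integrable_const _),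
      integral_sub h2 (h1.const_mul _), integral_const_mul]
    simp
  rw [key, key]
  ring

/-- The Efron–Stein bound for functions that are `1`-Lipschitz in every coordinate. -/
theorem integral_sub_integral_sq_le {D : Measure ℝ} [IsProbabilityMeasure D]
    (hD : ∀ᵐ x ∂D, x ∈ Set.Icc (0 : ℝ) 1) (n : ℕ) (f : (Fin n → ℝ) → ℝ)
    (hf : ∀ v w, |f v - f w| ≤ ∑ i, |v i - w i|) (m : ℝ) :
    ∫ u, (f u - ∫ v, f v ∂(Measure.pi fun _ : Fin n => D)) ^ 2 ∂(Measure.pi fun _ : Fin n => D) ≤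
      n * ∫ x, (x - m) ^ 2 ∂D := by
  induction n with
  | zero =>
    have : ∀ u, f u = f 0 := fun u => by rw [Subsingleton.elim u 0]
    simp [this]
  | succ n ih =>
    set P := Measure.pi fun _ : Fin n => D with hP
    set T : ℝ × (Fin n → ℝ) → (Fin (n + 1) → ℝ) := fun z => Fin.cons z.1 z.2 with hT
    have hmp : MeasurePreserving T (D.prod P) (Measure.pi fun _ : Fin (n + 1) => D) := by
      have := (measurePreserving_piFinSuccAbove (fun _ : Fin (n + 1) => D) 0).symm
      convert this using 1
      ext z i
      refine Fin.cases ?_ (fun j => ?_) i <;> simp [hT, MeasurableEquiv.piFinSuccAbove]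
    have hfc := continuous_of_abs_sub_le_sum hf
    have hslice : ∀ x v w, |f (Fin.cons x v) - f (Fin.cons x w)| ≤ ∑ i, |v i - w i| := by
      intro x v w
      refine (hf _ _).trans_eq ?_
      rw [Fin.sum_univ_succ]
      simp
    have hfirst : ∀ x y v, |f (Fin.cons x v) - f (Fin.cons y v)| ≤ |x - y| := by
      intro x y v
      refine (hf _ _).trans_eq ?_
      rw [Fin.sum_univ_succ]
      simp
    have hsi : ∀ x, Integrable (fun v => f (Fin.cons x v)) P ∧
        Integrable (fun v => f (Fin.cons x v) ^ 2) P := by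
      intro x
      have hc := continuous_of_abs_sub_le_sum (hslice x)
      have hb := ae_abs_le_of_abs_sub_le_sum hD (hslice x)
      refine ⟨Integrable.of_bound hc.aestronglyMeasurable _ hb,
        Integrable.of_bound (hc.pow 2).aestronglyMeasurable
          ((|f (Fin.cons x 0)| + n) ^ 2) ?_⟩
      filter_upwards [hb] with v hv
      rw [norm_pow]
      exact pow_le_pow_left₀ (norm_nonneg _) hv 2
    -- Averaging out all coordinates but the first keeps the Lipschitz bound; the variance splits
    -- into the variance of `g` and the mean variance of the slices, which the induction hypothesis
    -- controls.
    set g : ℝ → ℝ := fun x => ∫ v, f (Fin.cons x v) ∂P with hg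
    have hgl : ∀ x y, |g x - g y| ≤ |x - y| := by
      intro x y
      rw [hg]
      simp only
      rw [← integral_sub (hsi x).1 (hsi y).1]
      have := norm_integral_le_of_norm_le_const (μ := P)
        (f := fun v => f (Fin.cons x v) - f (Fin.cons y v)) (C := |x - y|)
        (ae_of_all _ fun v => hfirst x y v)
      simpa using this
    have hgc : Continuous g := by
      refine continuous_iff_continuousAt.2 fun y => ?_
      rw [ContinuousAt, tendsto_iff_dist_tendsto_zero]
      refine squeeze_zero (fun _ => dist_nonneg) (fun w => hgl w y) ?_
      have : Continuous fun w : ℝ => |w - y| := by fun_prop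
      simpa using this.tendsto y
    have hfb := ae_abs_le_of_abs_sub_le_sum hD hf
    have hfi : Integrable f (Measure.pi fun _ : Fin (n + 1) => D) :=
      Integrable.of_bound hfc.aestronglyMeasurable _ hfb
    set c := ∫ v, f v ∂(Measure.pi fun _ : Fin (n + 1) => D) with hc
    have hfi2 : Integrable (fun u => (f u - c) ^ 2) (Measure.pi fun _ : Fin (n + 1) => D) := by
      refine Integrable.of_bound ((hfc.sub continuous_const).pow 2).aestronglyMeasurable
        ((|f 0| + ↑(n + 1) + |c|) ^ 2) ?_
      filter_upwards [hfb] with v hv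
      rw [norm_pow]
      refine pow_le_pow_left₀ (norm_nonneg _) ((norm_sub_le _ _).trans ?_) 2
      rw [Real.norm_eq_abs c]
      linarith
    have hfub : ∀ F : (Fin (n + 1) → ℝ) → ℝ,
        Integrable F (Measure.pi fun _ : Fin (n + 1) => D) →
        ∫ u, F u ∂(Measure.pi fun _ : Fin (n + 1) => D) =
          ∫ x, ∫ v, F (Fin.cons x v) ∂P ∂D := by
      intro F hF
      have h1 := integral_map (μ := D.prod P) hmp.measurable.aemeasurable (f := F)
        (by rw [hmp.map_eq]; exact hF.1)
      rw [hmp.map_eq] at h1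
      exact h1.trans (integral_prod _ (hmp.integrable_comp_of_integrable hF))
    have hcg : c = ∫ x, g x ∂D := hfub f hfi
    have hgb : ∀ᵐ x ∂D, ‖g x‖ ≤ |g 0| + 1 := by
      filter_upwards [hD] with x hx
      have h1 := hgl x 0
      rw [sub_zero, abs_of_nonneg hx.1] at h1
      have h2 := abs_add_le (g 0) (g x - g 0)
      rw [add_sub_cancel] at h2
      rw [Real.norm_eq_abs]
      linarith [hx.2]
    have hgi : Integrable g D := Integrable.of_bound hgc.aestronglyMeasurable _ hgb
    have hgsq : ∀ a : ℝ, Integrable (fun x => (g x - a) ^ 2) D := by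
      intro a
      refine Integrable.of_bound ((hgc.sub continuous_const).pow 2).aestronglyMeasurable
        ((|g 0| + 1 + |a|) ^ 2) ?_
      filter_upwards [hgb] with x hx
      rw [norm_pow]
      refine pow_le_pow_left₀ (norm_nonneg _) ((norm_sub_le _ _).trans ?_) 2
      rw [Real.norm_eq_abs a]
      linarith
    have hgi2 : Integrable (fun x => g x ^ 2) D := by simpa using hgsq 0
    have hid2 : Integrable (fun x : ℝ => (x - m) ^ 2) D := by
      refine Integrable.of_bound (by fun_prop) ((1 + |m|) ^ 2) ?_
      filter_upwards [hD] with x hx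
      rw [norm_pow]
      refine pow_le_pow_left₀ (norm_nonneg _) ((norm_sub_le _ _).trans ?_) 2
      rw [Real.norm_eq_abs m, Real.norm_eq_abs, abs_of_nonneg hx.1]
      linarith [hx.2]
    -- The mean `c` of `g` minimizes the quadratic deviation, so it may be compared with `g m`.
    have hvar : ∫ x, (g x - c) ^ 2 ∂D ≤ ∫ x, (x - m) ^ 2 ∂D := by
      have h1 := integral_sub_sq_eq hgi hgi2 (g m)
      rw [← hcg] at h1
      have h2 : ∫ x, (g x - g m) ^ 2 ∂D ≤ ∫ x, (x - m) ^ 2 ∂D :=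
        integral_mono (hgsq _) hid2 fun x => sq_le_sq.2 (hgl x m)
      have := sq_nonneg (c - g m)
      linarith
    rw [hfub _ hfi2]
    calc ∫ x, ∫ v, (f (Fin.cons x v) - c) ^ 2 ∂P ∂D
        ≤ ∫ x, (n * ∫ x, (x - m) ^ 2 ∂D) + (g x - c) ^ 2 ∂D := by
          refine integral_mono_of_nonneg (ae_of_all _ fun x => integral_nonneg fun v => sq_nonneg _)
            ((integrable_const _).add (hgsq c)) (ae_of_all _ fun x => ?_)
          simp only
          rw [integral_sub_sq_eq (hsi x).1 (hsi x).2 c]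
          have := ih _ (hslice x)
          simp only [hg]
          linarith
      _ = n * ∫ x, (x - m) ^ 2 ∂D + ∫ x, (g x - c) ^ 2 ∂D := by
          rw [integral_add (integrable_const _) (hgsq c)]
          simp
      _ ≤ ↑(n + 1) * ∫ x, (x - m) ^ 2 ∂D := by
          push_cast
          linarith

/-! ### Moments -/

theorem integrable_id_of_hasLogConcaveDensity {D : Measure ℝ} (hD : HasLogConcaveDensity D) :
    Integrable (fun x : ℝ => x) D := by
  have := IsProbabilityMeasure.of_hasLogConcaveDensity hD
  exact Integrable.of_mem_Icc 0 1 aemeasurable_id (ae_mem_Icc_of_hasLogConcaveDensity hD)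

theorem integral_pos_of_hasLogConcaveDensity {D : Measure ℝ} (hD : HasLogConcaveDensity D) :
    0 < ∫ x, x ∂D := by
  have := IsProbabilityMeasure.of_hasLogConcaveDensity hD
  have hpos := ae_pos_of_hasLogConcaveDensity hD
  rw [integral_pos_iff_support_of_nonneg_ae (hpos.mono fun x hx => hx.le)
    (integrable_id_of_hasLogConcaveDensity hD)]
  have h : Function.support (fun x : ℝ => x) =ᵐ[D] Set.univ := by
    filter_upwards [hpos] with x hx
    simp only [eq_iff_iff]
    exact ⟨fun _ => trivial, fun _ => hx.ne'⟩
  rw [measure_congr h, measure_univ]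
  exact one_pos

theorem tail_two_mul_mean_le {D : Measure ℝ} (hD : HasLogConcaveDensity D) :
    tail D (2 * ∫ x, x ∂D) ≤ 1 / 2 := by
  have := IsProbabilityMeasure.of_hasLogConcaveDensity hD
  have hμ := integral_pos_of_hasLogConcaveDensity hD
  have h := mul_meas_ge_le_integral_of_nonneg
    ((ae_pos_of_hasLogConcaveDensity hD).mono fun x hx => hx.le)
    (integrable_id_of_hasLogConcaveDensity hD) (2 * ∫ x, x ∂D)
  have h2 : tail D (2 * ∫ x, x ∂D) ≤ D.real {x | 2 * ∫ x, x ∂D ≤ x} :=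
    measureReal_mono fun x hx => (Set.mem_Ioi.1 hx).le
  nlinarith

/-- Markov's inequality at twice the mean, propagated to multiples by `tail_div_le` with `β = 1 /
j`. -/
theorem tail_nat_mul_le {D : Measure ℝ} (hD : HasLogConcaveDensity D) (j : ℕ) :
    tail D (j * (2 * ∫ x, x ∂D)) ≤ (1 / 2) ^ j := by
  have := IsProbabilityMeasure.of_hasLogConcaveDensity hD
  have hμ := integral_pos_of_hasLogConcaveDensity hD
  rcases Nat.eq_zero_or_pos j with rfl | hj
  · simpa using tail_le_one D 0
  have hj' : (1 : ℝ) ≤ j := by exact_mod_cast hj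
  have h := tail_div_le hD (x := 2 * ∫ x, x ∂D) (β := 1 / j) (by linarith) (by positivity)
    (by rw [div_le_one (by linarith)]; exact hj')
  rw [one_div_one_div, Real.rpow_natCast, div_div_eq_mul_div, div_one, mul_comm] at h
  exact h.trans (pow_le_pow_left₀ (tail_nonneg _ _) (tail_two_mul_mean_le hD) j)

theorem sum_range_two_mul_add_one (N : ℕ) :
    ∑ j ∈ Finset.range N, (2 * (j : ℝ) + 1) = (N : ℝ) ^ 2 := by
  induction N with
  | zero => simp
  | succ N ih => rw [Finset.sum_range_succ, ih]; push_cast; ring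

theorem sum_range_odd_mul_half_pow_le (N : ℕ) :
    ∑ j ∈ Finset.range N, (2 * (j : ℝ) + 1) * (1 / 2) ^ j ≤ 6 := by
  have h : ∑ j ∈ Finset.range N, (2 * (j : ℝ) + 1) * (1 / 2) ^ j =
      6 - (4 * N + 6) * (1 / 2) ^ N := by
    induction N with
    | zero => simp
    | succ N ih => rw [Finset.sum_range_succ, ih]; push_cast; ring
  rw [h]
  have : (0 : ℝ) ≤ (4 * N + 6) * (1 / 2) ^ N := by positivity
  linarith

/-- With `M = ⌈x / a⌉`, the indicators with `j < M` equal `1`, and the first `M` odd numbers add up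
to `M ^ 2`. -/
theorem sq_le_sum_indicator {a x : ℝ} (ha : 0 < a) (hx : 0 ≤ x) {N : ℕ} (hN : x ≤ N * a) :
    x ^ 2 ≤ a ^ 2 * ∑ j ∈ Finset.range N,
      (2 * (j : ℝ) + 1) * (Set.Ioi ((j : ℝ) * a)).indicator (fun _ => (1 : ℝ)) x := by
  set M := ⌈x / a⌉₊ with hM
  have hMN : M ≤ N := by
    rw [hM, Nat.ceil_le, div_le_iff₀ ha]
    exact hN
  have h1 : x ≤ M * a := by
    rw [← div_le_iff₀ ha]
    exact Nat.le_ceil _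
  have h2 : (M : ℝ) ^ 2 ≤ ∑ j ∈ Finset.range N,
      (2 * (j : ℝ) + 1) * (Set.Ioi ((j : ℝ) * a)).indicator (fun _ => (1 : ℝ)) x := by
    rw [← sum_range_two_mul_add_one]
    refine (Finset.sum_le_sum fun j hj => ?_).trans
      (Finset.sum_le_sum_of_subset_of_nonneg (Finset.range_subset_range.2 hMN) fun j _ _ => ?_)
    · have : x ∈ Set.Ioi ((j : ℝ) * a) := by
        rw [Set.mem_Ioi, ← lt_div_iff₀ ha]
        exact Nat.lt_ceil.1 (Finset.mem_range.1 hj)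
      rw [Set.indicator_of_mem this, mul_one]
    · exact mul_nonneg (by positivity) (Set.indicator_nonneg (fun _ _ => zero_le_one) _)
  calc x ^ 2 ≤ (M * a) ^ 2 := pow_le_pow_left₀ hx h1 2
    _ = a ^ 2 * (M : ℝ) ^ 2 := by ring
    _ ≤ _ := mul_le_mul_of_nonneg_left h2 (sq_nonneg a)

/-- A reverse moment inequality from the geometric decay of the tail at multiples of twice the mean.
It makes the variance bounds scale with the mean, uniformly in `D`. -/
theorem integral_sq_le {D : Measure ℝ} (hD : HasLogConcaveDensity D) :
    ∫ x, x ^ 2 ∂D ≤ 24 * (∫ x, x ∂D) ^ 2 := by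
  have := IsProbabilityMeasure.of_hasLogConcaveDensity hD
  have hμ := integral_pos_of_hasLogConcaveDensity hD
  set a := 2 * ∫ x, x ∂D with ha
  have ha0 : 0 < a := by linarith
  obtain ⟨N, hN⟩ := exists_nat_ge (1 / a)
  rw [div_le_iff₀ ha0] at hN
  have hint : ∀ j : ℕ, Integrable (fun x => (2 * (j : ℝ) + 1) *
      (Set.Ioi ((j : ℝ) * a)).indicator (fun _ => (1 : ℝ)) x) D := fun j =>
    ((integrable_const _).indicator measurableSet_Ioi).const_mul _
  calc ∫ x, x ^ 2 ∂D ≤ ∫ x, a ^ 2 * ∑ j ∈ Finset.range N,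
      (2 * (j : ℝ) + 1) * (Set.Ioi ((j : ℝ) * a)).indicator (fun _ => (1 : ℝ)) x ∂D := by
        refine integral_mono_of_nonneg (ae_of_all _ fun x => sq_nonneg x)
          ((integrable_finsetSum _ fun j _ => hint j).const_mul _) ?_
        filter_upwards [ae_mem_Icc_of_hasLogConcaveDensity hD] with x hx
        exact sq_le_sum_indicator ha0 hx.1 (hx.2.trans hN)
    _ = a ^ 2 * ∑ j ∈ Finset.range N, (2 * (j : ℝ) + 1) * tail D (j * a) := by
        rw [integral_const_mul, integral_finsetSum _ fun j _ => hint j]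
        congr 1
        refine Finset.sum_congr rfl fun j _ => ?_
        rw [integral_const_mul]
        congr 1
        exact integral_indicator_one measurableSet_Ioi
    _ ≤ a ^ 2 * ∑ j ∈ Finset.range N, (2 * (j : ℝ) + 1) * (1 / 2) ^ j :=
        mul_le_mul_of_nonneg_left (Finset.sum_le_sum fun j _ =>
          mul_le_mul_of_nonneg_left (tail_nat_mul_le hD j) (by positivity)) (sq_nonneg a)
    _ ≤ a ^ 2 * 6 := mul_le_mul_of_nonneg_left (sum_range_odd_mul_half_pow_le N) (sq_nonneg a)
    _ = 24 * (∫ x, x ∂D) ^ 2 := by rw [ha]; ring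

end

/-! ### Expected top sums and the expectation of a ratio. -/

noncomputable section

variable {n p : ℕ}

theorem integral_eval_pi {D : Measure ℝ} [IsProbabilityMeasure D] (i : Fin n) :
    ∫ u, u i ∂(Measure.pi fun _ : Fin n => D) = ∫ x, x ∂D :=
  integral_comp_eval (μ := fun _ : Fin n => D) (f := fun x : ℝ => x) (i := i)
    measurable_id.aestronglyMeasurable

theorem integrable_eval_pi {D : Measure ℝ} (hD : HasLogConcaveDensity D) [IsProbabilityMeasure D]
    (i : Fin n) : Integrable (fun u : Fin n → ℝ => u i) (Measure.pi fun _ : Fin n => D) :=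
  (measurePreserving_eval (fun _ : Fin n => D) i).integrable_comp_of_integrable
    (integrable_id_of_hasLogConcaveDensity hD)

theorem integral_sum_pi {D : Measure ℝ} (hD : HasLogConcaveDensity D) [IsProbabilityMeasure D]
    (S : Finset (Fin n)) :
    ∫ u, ∑ i ∈ S, u i ∂(Measure.pi fun _ : Fin n => D) = S.card * ∫ x, x ∂D := by
  rw [integral_finsetSum _ fun i _ => integrable_eval_pi hD i]
  simp [integral_eval_pi]

theorem integrable_topSum {D : Measure ℝ} (hD : HasLogConcaveDensity D) [IsProbabilityMeasure D]
    {k : ℕ} (hk : k ≤ n) : Integrable (topSum k) (Measure.pi fun _ : Fin n => D) :=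
  Integrable.of_bound (continuous_topSum hk).aestronglyMeasurable _
    (ae_abs_le_of_abs_sub_le_sum (ae_mem_Icc_of_hasLogConcaveDensity hD) (abs_topSum_sub_le hk))

theorem topSum_of_le {k : ℕ} (hk : n ≤ k) (v : Fin n → ℝ) : topSum k v = ∑ i, v i := by
  have : topSet k v = Finset.univ := by
    ext i
    simp only [topSet, Finset.mem_map_equiv, Finset.mem_filter, Finset.mem_univ, true_and,
      iff_true]
    omega
  rw [topSum_eq, this]

theorem expectedTopSum_of_le {D : Measure ℝ} (hD : HasLogConcaveDensity D)
    [IsProbabilityMeasure D] {k m : ℕ} (h : m ≤ k) :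
    expectedTopSum D k m = m * ∫ x, x ∂D := by
  simp only [expectedTopSum, topSum_of_le h]
  rw [integral_sum_pi hD]
  simp

theorem le_expectedTopSum {D : Measure ℝ} (hD : HasLogConcaveDensity D)
    [IsProbabilityMeasure D] {k m : ℕ} (h : k ≤ m) :
    k * ∫ x, x ∂D ≤ expectedTopSum D k m := by
  set S : Finset (Fin m) := Finset.univ.filter fun i => i.val < k with hS
  have hcard : S.card = k := by rw [hS, Fin.card_filter_val_lt, Nat.min_eq_right h]
  have h1 := integral_sum_pi hD S
  rw [hcard] at h1
  rw [← h1]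
  exact integral_mono (integrable_finsetSum _ fun i _ => integrable_eval_pi hD i)
    (integrable_topSum hD h) fun v => sum_le_topSum h hcard v

theorem expectedTopSum_le {D : Measure ℝ} (hD : HasLogConcaveDensity D)
    [IsProbabilityMeasure D] {k m : ℕ} (h : k ≤ m) :
    expectedTopSum D k m ≤ m * ∫ x, x ∂D := by
  have h1 := integral_sum_pi hD (Finset.univ : Finset (Fin m))
  rw [Finset.card_univ, Fintype.card_fin] at h1
  rw [← h1]
  refine integral_mono_ae (integrable_topSum hD h)
    (integrable_finsetSum _ fun i _ => integrable_eval_pi hD i) ?_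
  filter_upwards [ae_pi_of_ae D (ae_mem_Icc_of_hasLogConcaveDensity hD)] with v hv
  rw [topSum_eq]
  exact Finset.sum_le_sum_of_subset_of_nonneg (Finset.subset_univ _) fun i _ _ => (hv i).1

/-- The product is of second order. If `B ≥ b / 2`, the difference of the ratios is at most `2 * (|A
- a| + |B - b|) / b`; otherwise it is at most `1` and `b - B > b / 2` is already a large deviation.
-/
theorem ratio_deviation_le {A B a b : ℝ} (hB : 0 < B) (hA0 : 0 ≤ A) (hAB : A ≤ B) (hb : 0 < b)
    (ha0 : 0 ≤ a) (hab : a ≤ b) :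
    (A / B - a / b) * (b - B) ≤ ((A - a) ^ 2 + 3 * (B - b) ^ 2) / b := by
  rw [le_div_iff₀ hb]
  have hQ0 : 0 ≤ A / B := by positivity
  have hQ1 : A / B ≤ 1 := (div_le_one hB).2 hAB
  have hq0 : 0 ≤ a / b := by positivity
  have hq1 : a / b ≤ 1 := (div_le_one hb).2 hab
  rcases le_or_gt (b / 2) B with h | h
  · have h1 : (A / B - a / b) * B = (A - a) - a / b * (B - b) := by field_simp; ring
    have h2 : |(A / B - a / b) * B| ≤ |A - a| + |B - b| := by
      rw [h1]
      refine (abs_sub _ _).trans ?_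
      rw [abs_mul, abs_of_nonneg hq0]
      have := mul_le_mul_of_nonneg_right hq1 (abs_nonneg (B - b))
      linarith
    rw [abs_mul, abs_of_pos hB] at h2
    have h3 : |A / B - a / b| * b ≤ 2 * (|A - a| + |B - b|) := by
      have := mul_le_mul_of_nonneg_left h (abs_nonneg (A / B - a / b))
      linarith
    have h4 : (A / B - a / b) * (b - B) ≤ |A / B - a / b| * |B - b| := by
      rw [abs_sub_comm B b, ← abs_mul]
      exact le_abs_self _
    have h5 := mul_le_mul_of_nonneg_right h3 (abs_nonneg (B - b))
    have h6 := mul_le_mul_of_nonneg_right h4 hb.le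
    rw [← sq_abs (A - a), ← sq_abs (B - b)]
    nlinarith [sq_nonneg (|A - a| - |B - b|)]
  · have h1 : (A / B - a / b) * (b - B) ≤ b - B := by
      have : 0 ≤ b - B := by linarith
      nlinarith
    nlinarith [sq_nonneg (A - a)]

/-- The advantaged group collects almost the utility that the ratio of expectations suggests. -/
theorem integral_ratio_le {D : Measure ℝ} (hD : HasLogConcaveDensity D) [IsProbabilityMeasure D]
    {K : ℕ} (hK : 1 ≤ K) {G : Finset (Fin (2 * K))} (hG : G.card = K) :
    ∫ u, (∑ i ∈ G, u i) / topSum K u ∂(Measure.pi fun _ : Fin (2 * K) => D) ≤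
      (K * ∫ x, x ∂D + 192 * ∫ x, x ∂D) / expectedTopSum D K (2 * K) := by
  set P := Measure.pi fun _ : Fin (2 * K) => D with hP
  set μ := ∫ x, x ∂D with hμ
  set b := expectedTopSum D K (2 * K) with hb
  have hμ0 : 0 < μ := integral_pos_of_hasLogConcaveDensity hD
  have hK0 : (1 : ℝ) ≤ K := by exact_mod_cast hK
  have hKn : K ≤ 2 * K := by omega
  have hab : K * μ ≤ b := le_expectedTopSum hD hKn
  have hb0 : 0 < b := by nlinarith
  have hIcc := ae_mem_Icc_of_hasLogConcaveDensity hD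
  have hfacts : ∀ᵐ u ∂P, 0 < topSum K u ∧ 0 ≤ ∑ i ∈ G, u i ∧ ∑ i ∈ G, u i ≤ topSum K u := by
    filter_upwards [ae_pi_of_ae D (ae_pos_of_hasLogConcaveDensity hD)] with u hu
    have h1 := sum_le_topSum hKn hG u
    have h2 : 0 < ∑ i ∈ G, u i :=
      Finset.sum_pos (fun i _ => hu i) (Finset.card_pos.1 (by omega))
    exact ⟨h2.trans_le h1, h2.le, h1⟩
  have hlipG : ∀ v w : Fin (2 * K) → ℝ, |∑ i ∈ G, v i - ∑ i ∈ G, w i| ≤ ∑ i, |v i - w i| := by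
    intro v w
    rw [← Finset.sum_sub_distrib]
    exact (Finset.abs_sum_le_sum_abs _ _).trans
      (Finset.sum_le_sum_of_subset_of_nonneg (Finset.subset_univ _) fun i _ _ => abs_nonneg _)
  have hσ : ∫ x, (x - 0) ^ 2 ∂D ≤ 24 * μ ^ 2 := by simpa using integral_sq_le hD
  have hvarA := integral_sub_integral_sq_le hIcc (2 * K) (fun u => ∑ i ∈ G, u i) hlipG 0
  have hvarB := integral_sub_integral_sq_le hIcc (2 * K) (topSum K) (abs_topSum_sub_le hKn) 0
  have hEA : ∫ u, ∑ i ∈ G, u i ∂P = K * μ := by rw [hP, integral_sum_pi hD, hG]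
  have hEB : ∫ u, topSum K u ∂P = b := rfl
  rw [← hP, hEA] at hvarA
  rw [← hP, hEB] at hvarB
  have hsq : ∀ (f : (Fin (2 * K) → ℝ) → ℝ) (c : ℝ),
      (∀ v w, |f v - f w| ≤ ∑ i, |v i - w i|) → Integrable (fun u => (f u - c) ^ 2) P := by
    intro f c hf
    refine Integrable.of_bound
      (((continuous_of_abs_sub_le_sum hf).sub continuous_const).pow 2).aestronglyMeasurable
      ((|f 0| + ↑(2 * K) + |c|) ^ 2) ?_
    filter_upwards [ae_abs_le_of_abs_sub_le_sum hIcc hf] with v hv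
    rw [norm_pow]
    refine pow_le_pow_left₀ (norm_nonneg _) ((norm_sub_le _ _).trans ?_) 2
    rw [Real.norm_eq_abs c]
    linarith
  have hAi : Integrable (fun u : Fin (2 * K) → ℝ => ∑ i ∈ G, u i) P :=
    integrable_finsetSum _ fun i _ => integrable_eval_pi hD i
  have hBi : Integrable (topSum K) P := integrable_topSum hD hKn
  have hQm : Measurable fun u : Fin (2 * K) → ℝ => (∑ i ∈ G, u i) / topSum K u :=
    (Finset.measurable_sum _ fun i _ => measurable_pi_apply i).div
      (continuous_topSum hKn).measurable
  have hQi : Integrable (fun u : Fin (2 * K) → ℝ => (∑ i ∈ G, u i) / topSum K u) P := by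
    refine Integrable.of_mem_Icc 0 1 hQm.aemeasurable ?_
    filter_upwards [hfacts] with u hu
    exact ⟨div_nonneg hu.2.1 hu.1.le, (div_le_one hu.1).2 hu.2.2⟩
  set q := K * μ / b with hq
  have hupper : Integrable (fun u => ((∑ i ∈ G, u i - K * μ) ^ 2 + 3 * (topSum K u - b) ^ 2) / b)
      P :=
    ((hsq _ _ hlipG).add ((hsq _ _ (abs_topSum_sub_le hKn)).const_mul 3)).div_const b
  -- Linearization of the ratio: the last summand has expectation `K * μ`, and only the second-order
  -- product remains to be estimated.
  have hident : (fun u => b * ((∑ i ∈ G, u i) / topSum K u)) =ᵐ[P] fun u =>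
      (((∑ i ∈ G, u i) / topSum K u - q) * (b - topSum K u)) +
        (∑ i ∈ G, u i + q * (b - topSum K u)) := by
    filter_upwards [hfacts] with u hu
    have := hu.1.ne'
    field_simp
    ring
  have hbB : Integrable (fun u => b - topSum K u) P := (integrable_const b).sub hBi
  have hlin : Integrable (fun u => ∑ i ∈ G, u i + q * (b - topSum K u)) P :=
    hAi.add (hbB.const_mul q)
  have hlin' : ∫ u, (∑ i ∈ G, u i + q * (b - topSum K u)) ∂P = K * μ := by
    rw [integral_add hAi (hbB.const_mul q), integral_const_mul,
      integral_sub (integrable_const b) hBi, hEA, hEB]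
    simp
  have hmain : b * ∫ u, (∑ i ∈ G, u i) / topSum K u ∂P ≤
      ∫ u, (((∑ i ∈ G, u i - K * μ) ^ 2 + 3 * (topSum K u - b) ^ 2) / b +
        (∑ i ∈ G, u i + q * (b - topSum K u))) ∂P := by
    rw [← integral_const_mul]
    refine integral_mono_ae (hQi.const_mul b) (hupper.add hlin) ?_
    filter_upwards [hident, hfacts] with u hu hu'
    rw [hu]
    have := ratio_deviation_le hu'.1 hu'.2.1 hu'.2.2 hb0 (by positivity) hab
    linarith
  rw [integral_add hupper hlin, hlin', integral_div,
    integral_add (hsq _ _ hlipG) ((hsq _ _ (abs_topSum_sub_le hKn)).const_mul 3),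
    integral_const_mul] at hmain
  -- Both variances are at most `2 * K * 24 * μ ^ 2`; with weights `1` and `3` this gives `192 * K *
  -- μ ^ 2`, and `b ≥ K * μ`.
  have hdev : (∫ u, (∑ i ∈ G, u i - K * μ) ^ 2 ∂P + 3 * ∫ u, (topSum K u - b) ^ 2 ∂P) / b ≤
      192 * μ := by
    rw [div_le_iff₀ hb0]
    push_cast at hvarA hvarB
    have h1 : 2 * (K : ℝ) * ∫ x, (x - 0) ^ 2 ∂D ≤ 2 * K * (24 * μ ^ 2) :=
      mul_le_mul_of_nonneg_left hσ (by positivity)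
    have h2 : 192 * μ * (K * μ) ≤ 192 * μ * b := mul_le_mul_of_nonneg_left hab (by positivity)
    linarith
  rw [le_div_iff₀ hb0]
  linarith

/-! ### The utility ratio for vanishing `β` -/

theorem measurable_utility_stable (k : Fin p → ℕ) (G : Finset (Fin n)) (β : ℝ) :
    Measurable fun w : (Fin n → ℝ) × (Fin n → PrefList p) =>
      utility w.1 (stableAlgorithm k (estimated G β w.1) w.2) := by
  have h : ∀ w : (Fin n → ℝ) × (Fin n → PrefList p),
      utility w.1 (stableAlgorithm k (estimated G β w.1) w.2) =
        ∑ i, if stableAlgorithm k (estimated G β w.1) w.2 i ≠ none then w.1 i else 0 := by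
    intro w
    rw [utility, selected, Finset.sum_filter]
  simp only [h]
  refine Finset.measurable_sum _ fun i _ => Measurable.ite ?_ (by fun_prop) measurable_const
  exact (measurable_stable_comp (E := Prop) k G β fun _ M => M i ≠ none).setOf

/-- Dominated convergence: the integrand is bounded by `1` and, for almost every instance, constant
once `β` is small. -/
theorem tendsto_utilityRatio {D : Measure ℝ} (hD : HasLogConcaveDensity D)
    [IsProbabilityMeasure D] (L : Measure (PrefList p)) [IsProbabilityMeasure L] {k : Fin p → ℕ}
    {K : ℕ} (hkK : ∑ l, k l = K) (hKn : K ≤ n) {G : Finset (Fin n)} (hG : G.card = K) :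
    Tendsto (fun β : ℝ => utilityRatio D L G K β (stableAlgorithm k)) (𝓝[>] 0)
      (𝓝 (∫ u, (∑ i ∈ G, u i) / topSum K u ∂(Measure.pi fun _ : Fin n => D))) := by
  have hlim : ∫ u, (∑ i ∈ G, u i) / topSum K u ∂(Measure.pi fun _ : Fin n => D) =
      ∫ w, (∑ i ∈ G, w.1 i) / topSum K w.1 ∂(instanceLaw D L n) := by
    have := integral_fun_fst (μ := Measure.pi fun _ : Fin n => D)
      (ν := Measure.pi fun _ : Fin n => L)
      fun u : Fin n → ℝ => (∑ i ∈ G, u i) / topSum K u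
    rw [instanceLaw]
    simpa using this.symm
  rw [hlim]
  refine tendsto_integral_filter_of_dominated_convergence (fun _ => 1) ?_ ?_
    (integrable_const _) ?_
  · refine Eventually.of_forall fun β => Measurable.aestronglyMeasurable ?_
    exact (measurable_utility_stable k G β).div
      ((continuous_topSum hKn).measurable.comp measurable_fst)
  · refine Eventually.of_forall fun β => ?_
    filter_upwards [ae_instanceLaw_of_ae D L
      (ae_pi_of_ae D (ae_pos_of_hasLogConcaveDensity hD))] with w hw
    have h1 : 0 ≤ utility w.1 (stableAlgorithm k (estimated G β w.1) w.2) :=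
      Finset.sum_nonneg fun i _ => (hw i).le
    have h2 : utility w.1 (stableAlgorithm k (estimated G β w.1) w.2) ≤ topSum K w.1 := by
      rw [utility, selected_stableAlgorithm, hkK]
      exact sum_le_topSum hKn (card_topSet hKn _) _
    rw [Real.norm_eq_abs, abs_of_nonneg (div_nonneg h1 (h1.trans h2))]
    exact div_le_one_of_le₀ h2 (h1.trans h2)
  · filter_upwards [ae_instanceLaw_of_ae D L
      (ae_pi_of_ae D (ae_pos_of_hasLogConcaveDensity hD)), ae_instanceLaw_of_ae D L
      (ae_pi_of_ae D (ae_mem_Icc_of_hasLogConcaveDensity hD))] with w hw hw1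
    refine tendsto_const_nhds.congr' ?_
    -- Utilities are at most `1`, so disadvantaged estimates are at most `β`; below the smallest
    -- utility the groups are separated.
    have hev : ∀ᶠ β : ℝ in 𝓝[>] 0, ∀ i, β < w.1 i := by
      rw [eventually_all]
      intro i
      filter_upwards [Ioo_mem_nhdsGT (hw i)] with β hβ
      exact hβ.2
    filter_upwards [hev, self_mem_nhdsWithin] with β hβ hβ0
    have hβ0 : 0 < β := hβ0
    rw [utility, selected_stableAlgorithm, hkK, topSet_eq_of_separated hKn hG]
    intro a ha c hc
    simp only [estimated, ha, hc, if_true, if_false]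
    have := mul_le_mul_of_nonneg_left (hw1 c).2 hβ0.le
    linarith [hβ a]

/-- For `m ≤ K` the top `m` of `K` draws have expected sum at least `m * μ ≥ 192 * μ`, which absorbs
the error. For `m ≥ K` the numerator is `2 * K * μ`, so the bound is at least `1`. -/
theorem integral_ratio_le_expectedTopSum {D : Measure ℝ} (hD : HasLogConcaveDensity D)
    [IsProbabilityMeasure D] {K m : ℕ} (hK : 1 ≤ K) (hm : 192 ≤ m) {G : Finset (Fin (2 * K))}
    (hG : G.card = K) :
    ∫ u, (∑ i ∈ G, u i) / topSum K u ∂(Measure.pi fun _ : Fin (2 * K) => D) ≤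
      (expectedTopSum D K K + expectedTopSum D m K) / expectedTopSum D K (2 * K) := by
  have hμ0 := integral_pos_of_hasLogConcaveDensity hD
  have hK0 : (1 : ℝ) ≤ K := by exact_mod_cast hK
  have hKn : K ≤ 2 * K := by omega
  have hb := le_expectedTopSum hD hKn
  have hb0 : 0 < expectedTopSum D K (2 * K) := by nlinarith
  rw [expectedTopSum_of_le hD le_rfl]
  rcases le_total m K with h | h
  · refine (integral_ratio_le hD hK hG).trans ?_
    refine div_le_div_of_nonneg_right ?_ hb0.le
    have h1 := le_expectedTopSum hD h
    have h2 : (192 : ℝ) ≤ m := by exact_mod_cast hm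
    have := mul_le_mul_of_nonneg_right h2 hμ0.le
    linarith
  · rw [expectedTopSum_of_le hD h]
    have h1 := expectedTopSum_le hD hKn
    push_cast at h1
    have h2 : (1 : ℝ) ≤ (K * ∫ x, x ∂D + K * ∫ x, x ∂D) / expectedTopSum D K (2 * K) := by
      rw [le_div_iff₀ hb0]
      linarith
    refine le_trans ?_ h2
    calc ∫ u, (∑ i ∈ G, u i) / topSum K u ∂(Measure.pi fun _ : Fin (2 * K) => D)
        ≤ ∫ u, (1 : ℝ) ∂(Measure.pi fun _ : Fin (2 * K) => D) := by
          refine integral_mono_of_nonneg ?_ (integrable_const _) ?_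
          · filter_upwards [ae_pi_of_ae D (ae_pos_of_hasLogConcaveDensity hD)] with u hu
            have h3 : 0 ≤ ∑ i ∈ G, u i := Finset.sum_nonneg fun i _ => (hu i).le
            exact div_nonneg h3 (h3.trans (sum_le_topSum hKn hG u))
          · filter_upwards [ae_pi_of_ae D (ae_pos_of_hasLogConcaveDensity hD)] with u hu
            have h3 : 0 ≤ ∑ i ∈ G, u i := Finset.sum_nonneg fun i _ => (hu i).le
            have h4 := sum_le_topSum hKn hG u
            exact div_le_one_of_le₀ h4 (h3.trans h4)
      _ = 1 := by simp

end

theorem mainTheorem4 :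
    ∃ C : ℝ, 0 < C ∧
      ∀ (D : Measure ℝ), HasLogConcaveDensity D →
      ∀ (n p K : ℕ) [NeZero p] (G₁ : Finset (Fin n)) (k : Fin p → ℕ)
        (L : Measure (PrefList p)) [IsProbabilityMeasure L],
        1 ≤ K → G₁.card = K → G₁ᶜ.card = K → (∀ l, 1 ≤ k l) → ∑ l, k l = K →
        (∀ β : ℝ, 0 < β → β ≤ 1 / 2 →
          (∀ A : SelectionAlgorithm n p, IsUtilityMaximizing k A →
            representationalFairness D L G₁ β A ≤
              2 * β * Real.log (1 / β) + C * (√(Real.log n) / √n)) ∧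
          preferenceFairness D L G₁ β (stableAlgorithm k) ≤
            2 * β * Real.log (1 / β) + C * (p * √(Real.log n) / √n)) ∧
        (2 ≤ K →
          ∃ v : ℝ,
            Tendsto (fun β : ℝ => utilityRatio D L G₁ K β (stableAlgorithm k)) (𝓝[>] 0) (𝓝 v) ∧
            v ≤ (expectedTopSum D K K + expectedTopSum D ⌊C * √(Real.log K)⌋₊ K) /
              expectedTopSum D K (2 * K)) := by
  refine ⟨300, by norm_num, ?_⟩
  intro D hD n p K _ G₁ k L _ hK hG hG' hk hkK
  have := IsProbabilityMeasure.of_hasLogConcaveDensity hD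
  refine ⟨fun β hβ hβ2 => ⟨fun A hA => ?_, ?_⟩, fun hK2 => ?_⟩
  · have h := representationalFairness_le hD L hA hK hkK hG hG' hβ hβ2
    have : 0 ≤ √(Real.log n) / √n := by positivity
    linarith
  · have h := preferenceFairness_le hD L hk hK hkK hG hG' hβ hβ2
    have h0 : 0 ≤ √(Real.log n) / √n := by positivity
    have hp : (1 : ℝ) ≤ p := by exact_mod_cast NeZero.one_le
    rw [mul_div_assoc]
    nlinarith
  · have hn : n = 2 * K := by have := card_add_self hG hG'; omega
    subst hn
    refine ⟨_, tendsto_utilityRatio hD L hkK (by omega) hG,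
      integral_ratio_le_expectedTopSum hD hK ?_ hG⟩
    -- For `K ≥ 2` one has `√(log K) ≥ 0.8`, and `300 * 0.8 = 240 ≥ 192`.
    refine Nat.le_floor ?_
    have h1 : 0.69 ≤ Real.log K := log_two_le (by exact_mod_cast hK2)
    have h2 : (0.8 : ℝ) ≤ √(Real.log K) := Real.le_sqrt_of_sq_le (by norm_num; linarith)
    push_cast
    linarith
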